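/- A Steiner triple system $\mathrm{STS}(v)$ is a set of $v$ points with a family of 3-element subsets (triples) such that any two different points lie in exactly one triple. A point $x$ is a \emph{Veblen point} if, whenever $\{x,a,b\},\{x,c,d\},\{t,a,c\}$ are triples, $\{t,b,d\}$ is a triple. The \emph{Steiner loop} of $\mathcal S$ is $\mathcal L_{\mathcal S}=\mathcal S\cup\{\Omega\}$ with identity $\Omega$, $x\cdot x=\Omega$, and $x\cdot y=z$ for every triple $\{x,y,z\}$. Its center $Z(\mathcal L_{\mathcal S})$ is the set of elements that commute and associate with all elements. A system $\mathcal Q$ is a \emph{quotient system} of $\mathcal S$ if $\mathcal L_{\mathcal Q}\cong\mathcal L_{\mathcal S}/Z(\mathcal L_{\mathcal S})$. A system is \emph{cyclic} if it has an automorphism that permutes all its points in a single cycle. For an STS $\mathcal Q$, a \emph{factor system} is a symmetric function $f:\mathcal L_{\mathcal Q}\times\mathcal L_{\mathcal Q}\to\mathbb Z/2$ with $f(P,\bar\Omega)=f(P,P)=0$ (where $\bar\Omega$ is the identity of $\mathcal L_{\mathcal Q}$) and $f(P,Q)=f(P,R)=f(Q,R)$ for every triple $\{P,Q,R\}$ of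 $\mathcal Q$. Its \emph{extension} is $\mathcal L_{\mathcal Q}\times\mathbb Z/2$ with product $(P,x)\circ(Q,y)=(PQ,\,x+y+f(P,Q))$. The \emph{extension classes} of $\mathcal Q$ are the factor systems modulo the coboundaries $(P,Q)\mapsto\varphi(P)+\varphi(Q)-\varphi(PQ)$, where $\varphi:\mathcal L_{\mathcal Q}\to\mathbb Z/2$ and $\varphi(\bar\Omega)=0$. The group $\mathrm{Aut}(\mathcal L_{\mathcal Q})$ acts on them by $(\beta f)(P,Q)=f(\beta^{-1}P,\beta^{-1}Q)$. \textbf{Theorem.} There are, up to isomorphism, exactly $1736$ $\mathrm{STS}(27)$s with exactly one Veblen point. Up to isomorphism there are exactly two $\mathrm{STS}(13)$s, one not cyclic and one cyclic, and every $\mathrm{STS}(27)$ with exactly one Veblen point has exactly one of these two as quotient system. Moreover: (1) If $\mathcal Q$ is the non-cyclic $\mathrm{STS}(13)$, there are up to isomorphism exactly $1504$ $\mathrm{STS}(27)$s with exactly one Veblen point and quotient system $\mathcal Q$. The groups $\mathrm{Aut}(\mathcal Q)$ and $\mathrm{Aut}(\mathcal L_{\mathcal Q})$ are isomorphic to $S_3$.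 There are $2^{13}$ extension classes of $\mathcal Q$, and they form $1504$ orbits under $\mathrm{Aut}(\mathcal L_{\mathcal Q})$. (2) If $\mathcal Q$ is the cyclic $\mathrm{STS}(13)$, there are up to isomorphism exactly $232$ $\mathrm{STS}(27)$s with exactly one Veblen point and quotient system $\mathcal Q$. The groups $\mathrm{Aut}(\mathcal Q)$ and $\mathrm{Aut}(\mathcal L_{\mathcal Q})$ are isomorphic to the Frobenius group $F_{39}$ of order $39$, that is, the group of the maps $x\mapsto ax+b$ of $\mathbb Z/13\mathbb Z$ with $a\in\{1,3,9\}$ and $b\in\mathbb Z/13\mathbb Z$. There are $2^{13}$ extension classes of $\mathcal Q$, and they form $232$ orbits under $\mathrm{Aut}(\mathcal L_{\mathcal Q})$. (3) In both cases, there is a bijection from the orbits of extension classes to the isomorphism classes of $\mathrm{STS}(27)$s with exactly one Veblen point and quotient system $\mathcal Q$. It sends the orbit of the class of $f$ to the isomorphism class of the systems $\mathcal S$ such that $\mathcal L_{\mathcal S}$ is isomorphic to the extension with factor system $f$. -/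

import Mathlib

/-- A Steiner triple system on the point set `α`: a family of 3-element subsets such that any two
different points lie in exactly one of them. -/
structure STS (α : Type*) where
  triples : Set (Set α)
  ncard_eq_three : ∀ t ∈ triples, t.ncard = 3
  existsUnique_triple : ∀ x y : α, x ≠ y → ∃! t, t ∈ triples ∧ x ∈ t ∧ y ∈ t

namespace STS

variable {α β : Type*}

/-- Isomorphism of Steiner triple systems: a bijection of the points carrying the triples of the
first exactly onto the triples of the second. -/
def Isomorphic (S : STS α) (T : STS β) : Prop :=
  ∃ σ : α ≃ β, ∀ t : Set α, t ∈ S.triples ↔ σ '' t ∈ T.triples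

theorem Isomorphic.refl (S : STS α) : S.Isomorphic S :=
  ⟨Equiv.refl α, fun t => by simp⟩

theorem Isomorphic.symm {S : STS α} {T : STS β} : S.Isomorphic T → T.Isomorphic S := by
  rintro ⟨σ, h⟩
  refine ⟨σ.symm, fun t => ?_⟩
  rw [h, Equiv.image_symm_image]

theorem Isomorphic.trans {γ : Type*} {S : STS α} {T : STS β} {U : STS γ} :
    S.Isomorphic T → T.Isomorphic U → S.Isomorphic U := by
  rintro ⟨σ, h⟩ ⟨τ, k⟩
  refine ⟨σ.trans τ, fun t => ?_⟩
  rw [h, k, Equiv.coe_trans, Set.image_comp]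

/-- The automorphism group of a Steiner triple system, as a group of permutations of its points. -/
def aut (S : STS α) : Subgroup (Equiv.Perm α) where
  carrier := {σ | ∀ t : Set α, t ∈ S.triples ↔ σ '' t ∈ S.triples}
  one_mem' := fun t => by simp
  mul_mem' := by
    intro σ τ hσ hτ t
    rw [hτ, hσ, Equiv.Perm.coe_mul, Set.image_comp]
  inv_mem' := by
    intro σ hσ t
    have h : σ '' ((σ⁻¹ : Equiv.Perm α) '' t) = t := by
      rw [← Set.image_comp, ← Equiv.Perm.coe_mul, mul_inv_cancel, Equiv.Perm.coe_one, Set.image_id]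
    rw [hσ ((σ⁻¹ : Equiv.Perm α) '' t), h]

/-- A system is cyclic if some automorphism permutes all the points in a single cycle. -/
def IsCyclic (S : STS α) : Prop :=
  ∃ σ ∈ S.aut, ∀ x y : α, σ.SameCycle x y

/-- Veblen points. -/
def IsVeblen (S : STS α) (x : α) : Prop :=
  ∀ a b c d t : α, {x, a, b} ∈ S.triples → {x, c, d} ∈ S.triples → {t, a, c} ∈ S.triples →
    {t, b, d} ∈ S.triples

theorem existsUnique_third (S : STS α) {x y : α} (h : x ≠ y) :
    ∃! z, ({x, y, z} : Set α) ∈ S.triples := by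
  obtain ⟨t, ⟨ht, hx, hy⟩, hu⟩ := S.existsUnique_triple x y h
  obtain ⟨a, b, c, hab, hac, hbc, rfl⟩ := Set.ncard_eq_three.1 (S.ncard_eq_three t ht)
  have key : ∃ z, ({x, y, z} : Set α) = {a, b, c} := by
    simp only [Set.mem_insert_iff, Set.mem_singleton_iff] at hx hy
    rcases hx with rfl | rfl | rfl <;> rcases hy with rfl | rfl | rfl <;>
      first
      | exact absurd rfl h
      | exact ⟨a, by ext; simp; tauto⟩
      | exact ⟨b, by ext; simp; tauto⟩
      | exact ⟨c, rfl⟩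
      | exact ⟨c, by ext; simp; tauto⟩
  obtain ⟨z, hz⟩ := key
  refine ⟨z, by simpa only [hz] using ht, fun w hw => ?_⟩
  have hw' : ({x, y, w} : Set α) = {x, y, z} := by
    rw [hz]; exact hu _ ⟨hw, by simp, by simp⟩
  have hwz : w ∈ ({x, y, z} : Set α) := by rw [← hw']; simp
  have h3 := S.ncard_eq_three _ hw
  simp only [Set.mem_insert_iff, Set.mem_singleton_iff] at hwz
  have h2 := Set.ncard_insert_le x ({y} : Set α)
  rw [Set.ncard_singleton] at h2
  rcases hwz with rfl | rfl | rfl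
  · have : ({w, y, w} : Set α) = {w, y} := by ext; simp; tauto
    rw [this] at h3; omega
  · have : ({x, w, w} : Set α) = {x, w} := by ext; simp
    rw [this] at h3; omega
  · rfl

/-- The third point of the triple through two different points. -/
noncomputable def third (S : STS α) {x y : α} (h : x ≠ y) : α :=
  (S.existsUnique_third h).choose

theorem third_mem (S : STS α) {x y : α} (h : x ≠ y) :
    ({x, y, S.third h} : Set α) ∈ S.triples :=
  (S.existsUnique_third h).choose_spec.1

theorem eq_third (S : STS α) {x y z : α} (h : x ≠ y) (hz : ({x, y, z} : Set α) ∈ S.triples) :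
    z = S.third h :=
  (S.existsUnique_third h).choose_spec.2 z hz

/-- The underlying set of the Steiner loop: the points together with one additional point `none`,
which is the identity element. -/
def Loop (_S : STS α) : Type _ := Option α

/-- A point, as an element of the Steiner loop. -/
def pt (S : STS α) (x : α) : S.Loop := (some x : Option α)

instance (S : STS α) : One S.Loop := ⟨(none : Option α)⟩

open Classical in
/-- The product of the Steiner loop. -/
noncomputable def loopMul (S : STS α) : Option α → Option α → Option α
  | none, y => y
  | some x, none => some x
  | some x, some y => if h : x = y then none else some (S.third h)

noncomputable instance (S : STS α) : Mul S.Loop := ⟨S.loopMul⟩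

theorem loop_one_mul (S : STS α) (a : S.Loop) : 1 * a = a := rfl

theorem loop_mul_one (S : STS α) (a : S.Loop) : a * 1 = a := by
  rcases a with _ | x <;> rfl

theorem loop_mul_self (S : STS α) (a : S.Loop) : a * a = 1 := by
  rcases a with _ | x
  · rfl
  · change S.loopMul (some x) (some x) = none
    simp [loopMul]

theorem pt_mul_pt (S : STS α) {x y : α} (h : x ≠ y) : S.pt x * S.pt y = S.pt (S.third h) := by
  change S.loopMul (some x) (some y) = some (S.third h)
  simp [loopMul, h]

theorem pt_injective (S : STS α) {x y : α} (h : S.pt x = S.pt y) : x = y :=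
  Option.some_injective _ h

theorem eq_one_or_pt (S : STS α) (a : S.Loop) : a = 1 ∨ ∃ x, a = S.pt x := by
  rcases a with _ | x
  · exact Or.inl rfl
  · exact Or.inr ⟨x, rfl⟩

/-- The congruence of the Steiner loop whose classes are the cosets of the center (the set of the
elements that commute and associate with all elements). -/
noncomputable def centerCon (S : STS α) : Con S.Loop where
  r a b := ∃ z ∈ Set.center S.Loop, b = a * z
  iseqv := by
    refine ⟨fun a => ⟨1, ⟨fun b => ?_, fun b c => ?_, fun a b => ?_⟩, ?_⟩, ?_, ?_⟩
    · rw [commute_iff_eq, loop_one_mul, loop_mul_one]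
    · rw [loop_one_mul, loop_one_mul]
    · rw [loop_mul_one, loop_mul_one]
    · rw [loop_mul_one]
    · rintro a _ ⟨z, hz, rfl⟩
      exact ⟨z, hz, by rw [hz.right_assoc, loop_mul_self, loop_mul_one]⟩
    · rintro a _ _ ⟨z, hz, rfl⟩ ⟨w, hw, rfl⟩
      exact ⟨z * w, Set.mul_mem_center hz hw, hw.right_assoc a z⟩
  mul' := by
    rintro a _ c _ ⟨z, hz, rfl⟩ ⟨w, hw, rfl⟩
    refine ⟨z * w, Set.mul_mem_center hz hw, ?_⟩
    have h1 : (a * z) * c = (a * c) * z := by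
      rw [hz.right_assoc a c, ← (hz.comm c).eq, (hz.comm a).eq.symm, ← hz.left_assoc a c,
        (hz.comm (a * c)).eq, hz.right_assoc, (hz.comm c).eq]
    rw [← hw.right_assoc, h1, hw.right_assoc]

/-- `Q` is the quotient system of `S`: its Steiner loop is isomorphic to the quotient of the Steiner
loop of `S` by the center. -/
def IsQuotientSystem (S : STS α) (Q : STS β) : Prop :=
  Nonempty (S.centerCon.Quotient ≃* Q.Loop)

/-- The group of factor systems, with values in the group of order two. -/
def factorSystems (Q : STS α) : AddSubgroup (Q.Loop → Q.Loop → ZMod 2) where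
  carrier := {f | (∀ a b, f a b = f b a) ∧ (∀ a, f a 1 = 0) ∧ (∀ a, f a a = 0) ∧
    ∀ x y z : α, ({x, y, z} : Set α) ∈ Q.triples →
      f (Q.pt x) (Q.pt y) = f (Q.pt x) (Q.pt z) ∧ f (Q.pt x) (Q.pt z) = f (Q.pt y) (Q.pt z)}
  zero_mem' := by simp
  add_mem' := by
    rintro f g ⟨f1, f2, f3, f4⟩ ⟨g1, g2, g3, g4⟩
    refine ⟨fun a b => ?_, fun a => ?_, fun a => ?_, fun x y z h => ⟨?_, ?_⟩⟩ <;>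
      simp only [Pi.add_apply]
    · rw [f1, g1]
    · rw [f2, g2, add_zero]
    · rw [f3, g3, add_zero]
    · rw [(f4 x y z h).1, (g4 x y z h).1]
    · rw [(f4 x y z h).2, (g4 x y z h).2]
  neg_mem' := by
    rintro f ⟨f1, f2, f3, f4⟩
    refine ⟨fun a b => ?_, fun a => ?_, fun a => ?_, fun x y z h => ⟨?_, ?_⟩⟩ <;>
      simp only [Pi.neg_apply]
    · rw [f1]
    · rw [f2, neg_zero]
    · rw [f3, neg_zero]
    · rw [(f4 x y z h).1]
    · rw [(f4 x y z h).2]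

/-- The Schreier extension of the group of order two by the Steiner loop of `Q`, with factor
system `f`. -/
def Extension (Q : STS α) (_f : Q.factorSystems) : Type _ := Q.Loop × ZMod 2

noncomputable instance (Q : STS α) (f : Q.factorSystems) : Mul (Q.Extension f) :=
  ⟨fun p q => ((p.1 * q.1, p.2 + q.2 + f.1 p.1 q.1) : Q.Loop × ZMod 2)⟩

/-- The group of coboundaries. -/
def coboundaries (Q : STS α) : AddSubgroup (Q.Loop → Q.Loop → ZMod 2) where
  carrier := {f | ∃ φ : Q.Loop → ZMod 2, φ 1 = 0 ∧ ∀ a b, f a b = φ a + φ b - φ (a * b)}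
  zero_mem' := ⟨0, by simp⟩
  add_mem' := by
    rintro f g ⟨φ, h1, h2⟩ ⟨ψ, k1, k2⟩
    refine ⟨φ + ψ, by simp [h1, k1], fun a b => ?_⟩
    simp only [Pi.add_apply, h2, k2]
    ring
  neg_mem' := by
    rintro f ⟨φ, h1, h2⟩
    refine ⟨-φ, by simp [h1], fun a b => ?_⟩
    simp only [Pi.neg_apply, h2]
    ring

/-- The equivalence classes of extensions: factor systems modulo coboundaries. -/
abbrev ExtClasses (Q : STS α) : Type _ :=
  Q.factorSystems ⧸ Q.coboundaries.addSubgroupOf Q.factorSystems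

theorem loopAut_one (Q : STS α) (β : MulAut Q.Loop) : β 1 = 1 := by
  have h := map_mul β 1 1
  rw [loop_mul_self, loop_mul_self] at h
  exact h

theorem loopAut_triple (Q : STS α) (β : MulAut Q.Loop) {x y z : α}
    (h : ({x, y, z} : Set α) ∈ Q.triples) :
    ∃ x' y' z', β (Q.pt x) = Q.pt x' ∧ β (Q.pt y) = Q.pt y' ∧ β (Q.pt z) = Q.pt z' ∧
      ({x', y', z'} : Set α) ∈ Q.triples := by
  have hp : ∀ x, ∃ x', β (Q.pt x) = Q.pt x' := by
    intro x
    rcases Q.eq_one_or_pt (β (Q.pt x)) with h | h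
    · rw [← Q.loopAut_one β] at h
      exact absurd (β.injective h) (Option.some_ne_none x)
    · exact h
  obtain ⟨x', hx⟩ := hp x
  obtain ⟨y', hy⟩ := hp y
  obtain ⟨z', hz⟩ := hp z
  have hxy : x ≠ y := by
    rintro rfl
    have h3 := Q.ncard_eq_three _ h
    have h2 := Set.ncard_insert_le x ({z} : Set α)
    rw [Set.insert_eq_of_mem (Set.mem_insert x {z})] at h3
    rw [Set.ncard_singleton] at h2
    omega
  have hxy' : x' ≠ y' := by
    rintro rfl
    exact hxy (Q.pt_injective (β.injective (hx.trans hy.symm)))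
  refine ⟨x', y', z', hx, hy, hz, ?_⟩
  have hm := map_mul β (Q.pt x) (Q.pt y)
  rw [Q.pt_mul_pt hxy, ← Q.eq_third hxy h, hx, hy, hz, Q.pt_mul_pt hxy'] at hm
  rw [Q.pt_injective hm]
  exact Q.third_mem hxy'

/-- The action of the automorphism group of the Steiner loop on factor systems:
`(β • f) (a, b) = f (β⁻¹ a, β⁻¹ b)`. -/
noncomputable instance (Q : STS α) : DistribMulAction (MulAut Q.Loop) Q.factorSystems where
  smul β f := ⟨fun a b => f.1 (β⁻¹ a) (β⁻¹ b), by
    obtain ⟨f, f1, f2, f3, f4⟩ := f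
    refine ⟨fun a b => f1 _ _, fun a => ?_, fun a => f3 _, fun x y z h => ?_⟩
    · change f (β⁻¹ a) (β⁻¹ 1) = 0
      rw [loopAut_one, f2]
    · obtain ⟨x', y', z', hx, hy, hz, h'⟩ := Q.loopAut_triple β⁻¹ h
      change f (β⁻¹ _) (β⁻¹ _) = f (β⁻¹ _) (β⁻¹ _) ∧ f (β⁻¹ _) (β⁻¹ _) = f (β⁻¹ _) (β⁻¹ _)
      rw [hx, hy, hz]
      exact f4 x' y' z' h'⟩
  one_smul _ := rfl
  mul_smul _ _ _ := rfl
  smul_zero _ := rfl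
  smul_add _ _ _ := rfl

theorem smul_apply (Q : STS α) (β : MulAut Q.Loop) (f : Q.factorSystems) (a b : Q.Loop) :
    (β • f).1 a b = f.1 (β⁻¹ a) (β⁻¹ b) := rfl

theorem smul_coboundary (Q : STS α) (β : MulAut Q.Loop) :
    Q.coboundaries.addSubgroupOf Q.factorSystems ≤
      (Q.coboundaries.addSubgroupOf Q.factorSystems).comap
        (DistribSMul.toAddMonoidHom Q.factorSystems β) := by
  rintro f ⟨φ, h1, h2⟩
  refine ⟨fun a => φ (β⁻¹ a), ?_, fun a b => ?_⟩
  · change φ (β⁻¹ 1) = 0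
    rw [loopAut_one, h1]
  · change f.1 (β⁻¹ a) (β⁻¹ b) = φ (β⁻¹ a) + φ (β⁻¹ b) - φ (β⁻¹ (a * b))
    rw [map_mul]
    exact h2 _ _

/-- The induced action on the equivalence classes of extensions. -/
noncomputable instance (Q : STS α) : MulAction (MulAut Q.Loop) Q.ExtClasses where
  smul β := QuotientAddGroup.map _ _ (DistribSMul.toAddMonoidHom Q.factorSystems β)
    (Q.smul_coboundary β)
  one_smul c := by
    induction c using QuotientAddGroup.induction_on with
    | H f => rfl
  mul_smul β γ c := by
    induction c using QuotientAddGroup.induction_on with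
    | H f => rfl

/-- The orbits of the automorphism group of the Steiner loop on the classes of extensions. -/
abbrev ExtOrbits (Q : STS α) : Type _ := MulAction.orbitRel.Quotient (MulAut Q.Loop) Q.ExtClasses

/-- The orbit of the class of a factor system. -/
noncomputable def extOrbit (Q : STS α) (f : Q.factorSystems) : Q.ExtOrbits :=
  Quotient.mk (MulAction.orbitRel (MulAut Q.Loop) Q.ExtClasses) (QuotientAddGroup.mk f)

/-- Isomorphism, as an equivalence relation on the systems on `Fin v` that have the property `P`. -/
def isoSetoid (v : ℕ) (P : STS (Fin v) → Prop) : Setoid {S : STS (Fin v) // P S} where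
  r S T := S.1.Isomorphic T.1
  iseqv := ⟨fun S => Isomorphic.refl S.1, Isomorphic.symm, Isomorphic.trans⟩

/-- The isomorphism classes of the systems of order `v` that have the property `P`. -/
abbrev IsoClasses (v : ℕ) (P : STS (Fin v) → Prop) : Type := Quotient (isoSetoid v P)

/-- `S` has exactly one Veblen point. -/
def HasOneVeblen (S : STS α) : Prop := ∃! x, S.IsVeblen x

/-- `S` has exactly one Veblen point, and its quotient system is `Q`. -/
def HasOneVeblenOver (Q : STS β) (S : STS α) : Prop := S.HasOneVeblen ∧ S.IsQuotientSystem Q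

/-- The isomorphism classes of the systems of order 27 with exactly one Veblen point and quotient
system `Q` correspond to the orbits of the automorphism group on the classes of extensions, the
orbit of `f` to the class of the systems whose Steiner loop is isomorphic to the extension with
factor system `f`. -/
def ClassesCorrespondToOrbits (Q : STS (Fin 13)) : Prop :=
  ∃ e : Q.ExtOrbits ≃ IsoClasses 27 (HasOneVeblenOver Q),
    ∀ (f : Q.factorSystems) (S : {S : STS (Fin 27) // HasOneVeblenOver Q S}),
      e (Q.extOrbit f) = Quotient.mk _ S ↔ Nonempty (S.1.Loop ≃* Q.Extension f)

end STS

/-- The Frobenius group of order 39: the maps `x ↦ a x + b` of `ℤ/13ℤ` with `a ∈ {1, 3, 9}`. -/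
def frobenius39 : Subgroup (Equiv.Perm (ZMod 13)) where
  carrier := {σ | ∃ a ∈ ({1, 3, 9} : Set (ZMod 13)), ∃ b, ∀ x, σ x = a * x + b}
  one_mem' := ⟨1, by simp, 0, by simp⟩
  mul_mem' := by
    rintro σ τ ⟨a, ha, b, hσ⟩ ⟨c, hc, d, hτ⟩
    refine ⟨a * c, ?_, a * d + b, fun x => ?_⟩
    · simp only [Set.mem_insert_iff, Set.mem_singleton_iff] at *
      rcases ha with rfl | rfl | rfl <;> rcases hc with rfl | rfl | rfl <;> decide
    · rw [Equiv.Perm.mul_apply, hσ, hτ]; ring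
  inv_mem' := by
    rintro σ ⟨a, ha, b, hσ⟩
    have ha3 : a * a * a = 1 := by
      simp only [Set.mem_insert_iff, Set.mem_singleton_iff] at ha
      rcases ha with rfl | rfl | rfl <;> decide
    refine ⟨a * a, ?_, -(a * a * b), fun x => ?_⟩
    · simp only [Set.mem_insert_iff, Set.mem_singleton_iff] at *
      rcases ha with rfl | rfl | rfl <;> decide
    · rw [Equiv.Perm.inv_eq_iff_eq, hσ]
      linear_combination (b - x) * ha3

/-! The Veblen points of a system are the nontrivial central elements of its Steiner loop
(`isVeblen_iff`). So an STS(27) has exactly one of them when the centre of its loop, of order 28,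
has order two. The central quotient is then a Steiner loop of order 14, hence the loop of an STS(13)
(`exists_quotientSystem`), and a normalised section of the quotient map turns the loop into the
extension by a factor system (`exists_extension`). Conversely, the loops of both STS(13)s have
trivial centre, so the centre of any extension is the fibre over the identity (`center_ext`) and the
Veblen point is unique. An isomorphism of extensions preserves this centre, so it has the form (P,
x) ↦ (βP, φ(P) + x). That means that the factor systems differ by an automorphism and a coboundary,
which gives the bijection with orbits (`classesCorrespondToOrbits`).

The orbits are counted by Burnside's lemma (`Numbering.card_orbits`). A factor system is an
arbitrary function v on the 26 triples. A coboundary is a function δu that sums a function u of the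
13 points over each triple. For both systems δ is injective, which leaves 2^26 / 2^13 classes. The
class of v is fixed by σ iff v∘σ + v = δu for some u, necessarily unique, so the solutions (v, u) of
a linear system over the field of two elements are 2^13 times as many as the fixed classes
(`Numbering.card_fixedBy`). Their number comes from Gaussian elimination on natural numbers read as
bit vectors (`XorCount.card_solutions_eq`).

The STS(13)s are classified by an exhaustive search that the kernel evaluates and `search_sound`
justifies. A first run shows that each contains a Pasch configuration (four triples on six points).
A second run starts from such a configuration and matches every completion with one of two tables.
Three points of a Pasch configuration generate each of the two systems, so an automorphism is known
from three images, and a finite check leaves only S_3 and the affine maps. The orders 6 and 39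
distinguish the systems, and the two counts add up. -/

/-! ### Steiner loops as abstract structures -/

/-- The axioms of a Steiner loop with identity `o`. -/
structure IsSteinerLoop (L : Type*) [Mul L] (o : L) : Prop where
  one_mul : ∀ a : L, o * a = a
  mul_comm : ∀ a b : L, a * b = b * a
  mul_self : ∀ a : L, a * a = o
  mul_mul : ∀ a b : L, a * (a * b) = b

namespace IsSteinerLoop

variable {L M : Type*} [Mul L] [Mul M] {o : L} {u : M}

theorem mul_one (h : IsSteinerLoop L o) (a : L) : a * o = a := by
  rw [h.mul_comm, h.one_mul]

theorem mul_cancel (h : IsSteinerLoop L o) {a b c : L} (e : a * b = a * c) : b = c := by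
  rw [← h.mul_mul a b, e, h.mul_mul]

theorem mul_eq_one (h : IsSteinerLoop L o) {a b : L} (e : a * b = o) : a = b := by
  rw [← h.mul_self a] at e
  exact (h.mul_cancel e).symm

theorem map_one (h : IsSteinerLoop L o) (k : IsSteinerLoop M u) {F : Type*} [FunLike F L M]
    [MulHomClass F L M] (φ : F) : φ o = u := by
  have := _root_.map_mul φ o o
  rwa [h.mul_self, k.mul_self] at this

/-- Commutativity is an axiom here and converts associativity with `z` on the left into
associativity with `z` on the right. -/
theorem mem_center (h : IsSteinerLoop L o) {z : L} :
    z ∈ Set.center L ↔ ∀ b c : L, z * (b * c) = z * b * c := by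
  refine ⟨fun hz b c => hz.left_assoc b c, fun hz => ⟨fun a => h.mul_comm z a, hz, fun a b => ?_⟩⟩
  rw [h.mul_comm b z, h.mul_comm a (z * b), ← hz b a, h.mul_comm b a, h.mul_comm z]

theorem exists_equiv_option (L : Type*) (o : L) {n : ℕ} (hc : Nat.card L = n + 1) :
    ∃ e : L ≃ Option (Fin n), e o = none := by
  classical
  have : Finite L := Nat.finite_of_card_ne_zero (by omega)
  have e₀ : Nonempty (L ≃ Option (Fin n)) := Finite.card_eq.1 (by simp [hc])
  obtain ⟨e₀⟩ := e₀
  exact ⟨e₀.trans (Equiv.swap (e₀ o) none), by simp⟩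

end IsSteinerLoop

/-! ### Dictionary between Steiner triple systems and Steiner loops -/

namespace STS

variable {α β : Type*}

theorem isSteinerLoop_loop (S : STS α) : IsSteinerLoop S.Loop 1 := by
  classical
  have hsym : ∀ {x y : α} (h : x ≠ y), S.third h = S.third h.symm := fun {x y} h =>
    S.eq_third h.symm (by rw [Set.insert_comm]; exact S.third_mem h)
  have hne : ∀ {x y : α} (h : x ≠ y), x ≠ S.third h := by
    intro x y h e
    have h3 := S.ncard_eq_three _ (S.third_mem h)
    have h2 := Set.ncard_insert_le x ({y} : Set α)
    rw [Set.ncard_singleton] at h2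
    have : ({x, y, S.third h} : Set α) = {x, y} := by rw [← e]; ext; simp; tauto
    rw [this] at h3
    omega
  refine ⟨S.loop_one_mul, fun a b => ?_, S.loop_mul_self, fun a b => ?_⟩
  · rcases S.eq_one_or_pt a with rfl | ⟨x, rfl⟩ <;> rcases S.eq_one_or_pt b with rfl | ⟨y, rfl⟩
    · rfl
    · rw [loop_one_mul, loop_mul_one]
    · rw [loop_one_mul, loop_mul_one]
    · by_cases h : x = y
      · rw [h]
      · rw [S.pt_mul_pt h, S.pt_mul_pt (Ne.symm h), hsym]
  · rcases S.eq_one_or_pt a with rfl | ⟨x, rfl⟩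
    · rw [loop_one_mul, loop_one_mul]
    rcases S.eq_one_or_pt b with rfl | ⟨y, rfl⟩
    · rw [loop_mul_one, loop_mul_self]
    · by_cases h : x = y
      · rw [h, loop_mul_self, loop_mul_one]
      · rw [S.pt_mul_pt h, S.pt_mul_pt (hne h)]
        congr 1
        refine (S.eq_third _ ?_).symm
        have := S.third_mem h
        rwa [Set.pair_comm] at this

theorem pt_ne_one (S : STS α) (x : α) : S.pt x ≠ 1 := Option.some_ne_none x

theorem card_loop (S : STS α) [Finite α] : Nat.card S.Loop = Nat.card α + 1 :=
  Finite.card_option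

instance (S : STS α) [Finite α] : Finite S.Loop := inferInstanceAs (Finite (Option α))

theorem ne_of_mem_triples (S : STS α) {x y z : α} (h : ({x, y, z} : Set α) ∈ S.triples) :
    x ≠ y := by
  rintro rfl
  have h3 := S.ncard_eq_three _ h
  have h2 := Set.ncard_insert_le x ({z} : Set α)
  rw [Set.insert_eq_of_mem (Set.mem_insert x {z}), ] at h3
  rw [Set.ncard_singleton] at h2
  omega

theorem mem_triples_iff (S : STS α) {x y z : α} :
    ({x, y, z} : Set α) ∈ S.triples ↔ x ≠ y ∧ S.pt x * S.pt y = S.pt z := by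
  constructor
  · intro h
    have hne := S.ne_of_mem_triples h
    exact ⟨hne, by rw [S.pt_mul_pt hne, ← S.eq_third hne h]⟩
  · rintro ⟨hne, h⟩
    rw [S.pt_mul_pt hne] at h
    rw [← S.pt_injective h]
    exact S.third_mem hne

theorem exists_of_mem_triples (S : STS α) {t : Set α} (h : t ∈ S.triples) :
    ∃ x y z, t = {x, y, z} := by
  obtain ⟨a, b, c, -, -, -, rfl⟩ := Set.ncard_eq_three.1 (S.ncard_eq_three t h)
  exact ⟨a, b, c, rfl⟩

/-- The Steiner triple system of a totally symmetric idempotent product. -/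
def ofProd (m : α → α → α) (h1 : ∀ x, m x x = x) (h2 : ∀ x y, m x y = m y x)
    (h3 : ∀ x y, m x (m x y) = y) : STS α where
  triples := {t | ∃ x y, x ≠ y ∧ t = {x, y, m x y}}
  ncard_eq_three := by
    rintro _ ⟨x, y, hne, rfl⟩
    rw [Set.ncard_eq_three]
    refine ⟨x, y, m x y, hne, fun e => hne ?_, fun e => hne ?_, rfl⟩
    · have := h3 x y
      rwa [← e, h1] at this
    · have := h3 y x
      rw [h2 y x, ← e, h1] at this
      exact this.symm
  existsUnique_triple := by
    intro x y hne
    refine ⟨{x, y, m x y}, ⟨⟨x, y, hne, rfl⟩, by simp, by simp⟩, ?_⟩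
    rintro _ ⟨⟨a, b, hab, rfl⟩, hx, hy⟩
    simp only [Set.mem_insert_iff, Set.mem_singleton_iff] at hx hy
    have e1 : m b (m a b) = a := by rw [h2 a b, h3]
    rcases hx with rfl | rfl | rfl <;> rcases hy with rfl | rfl | rfl
    · exact absurd rfl hne
    · rfl
    · rw [h3]; ext; simp; tauto
    · rw [h2]; ext; simp; tauto
    · exact absurd rfl hne
    · rw [e1]; ext; simp; tauto
    · rw [h2 _ y, h3]; ext; simp; tauto
    · rw [h2 (m a y) y, e1]; ext; simp; tauto
    · exact absurd rfl hne

theorem ofProd_mul (m : α → α → α) (h1 : ∀ x, m x x = x) (h2 : ∀ x y, m x y = m y x)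
    (h3 : ∀ x y, m x (m x y) = y) {x y : α} (h : x ≠ y) :
    (ofProd m h1 h2 h3).pt x * (ofProd m h1 h2 h3).pt y = (ofProd m h1 h2 h3).pt (m x y) :=
  ((mem_triples_iff (ofProd m h1 h2 h3)).1 (show _ ∈ {_t | _} from ⟨x, y, h, rfl⟩)).2

/-- Removing the identity leaves the points, and two different points never multiply to the
identity, so their product is a third point. -/
theorem exists_loop_equiv {L : Type*} [Mul L] {o : L} (h : IsSteinerLoop L o) {n : ℕ}
    (hc : Nat.card L = n + 1) : ∃ S : STS (Fin n), Nonempty (S.Loop ≃* L) := by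
  obtain ⟨e, he⟩ := IsSteinerLoop.exists_equiv_option L o hc
  have he' : e.symm none = o := by rw [← he, e.symm_apply_apply]
  -- The default `x` in `getD` is used only when the product is the identity, that is, for equal
  -- points; there it makes the product idempotent.
  have key : ∀ {x y : Fin n}, x ≠ y →
      some ((e (e.symm (some x) * e.symm (some y))).getD x) =
        e (e.symm (some x) * e.symm (some y)) := by
    intro x y hne
    rcases hv : e (e.symm (some x) * e.symm (some y)) with _ | v
    · rw [← he] at hv
      have := h.mul_eq_one (e.injective hv)
      exact absurd (Option.some_injective _ (e.symm.injective this)) hne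
    · rfl
  have hself : ∀ x : Fin n, (e (e.symm (some x) * e.symm (some x))).getD x = x := by
    intro x; rw [h.mul_self, he]; rfl
  have hcomm : ∀ x y : Fin n, (e (e.symm (some x) * e.symm (some y))).getD x =
      (e (e.symm (some y) * e.symm (some x))).getD y := by
    intro x y
    by_cases hne : x = y
    · rw [hne]
    · apply Option.some_injective
      rw [key hne, key (Ne.symm hne), h.mul_comm]
  refine ⟨ofProd (fun x y => (e (e.symm (some x) * e.symm (some y))).getD x) hself hcomm ?_, ?_⟩
  · intro x y
    by_cases hne : x = y
    · subst hne
      simp only [hself]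
    · have hne' : x ≠ (e (e.symm (some x) * e.symm (some y))).getD x := by
        intro e1
        have e2 := key hne
        rw [← e1, ← e.symm_apply_eq] at e2
        have : e.symm (some x) * o = e.symm (some x) * e.symm (some y) := by
          rw [h.mul_one]; exact e2
        have := h.mul_cancel this
        rw [← he', e.symm.injective.eq_iff] at this
        cases this
      apply Option.some_injective
      rw [key hne', key hne, e.symm_apply_apply, h.mul_mul, e.apply_symm_apply]
  · refine ⟨⟨(e.symm : Option (Fin n) ≃ L), fun a b => ?_⟩⟩
    change e.symm (a * b) = e.symm a * e.symm b
    rcases eq_one_or_pt _ a with rfl | ⟨x, rfl⟩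
    · rw [loop_one_mul]
      change _ = e.symm none * _
      exact (he' ▸ h.one_mul _).symm
    rcases eq_one_or_pt _ b with rfl | ⟨y, rfl⟩
    · rw [loop_mul_one]
      change _ = _ * e.symm none
      exact (he' ▸ h.mul_one _).symm
    by_cases hne : x = y
    · subst hne
      rw [loop_mul_self, h.mul_self]
      exact he'
    · rw [ofProd_mul _ _ _ _ hne]
      change e.symm (some _) = e.symm (some _) * e.symm (some _)
      rw [key hne, e.symm_apply_apply]

/-- A bijection of the points that preserves products induces an isomorphism of Steiner loops. -/
def loopEquivOf {S : STS α} {T : STS β} (σ : α ≃ β)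
    (h : ∀ t : Set α, t ∈ S.triples ↔ σ '' t ∈ T.triples) : S.Loop ≃* T.Loop where
  toEquiv := (Equiv.optionCongr σ : Option α ≃ Option β)
  map_mul' := by
    intro a b
    have hpt : ∀ x, (Equiv.optionCongr σ) (S.pt x) = T.pt (σ x) := fun x => rfl
    rcases S.eq_one_or_pt a with rfl | ⟨x, rfl⟩
    · exact congrArg _ (loop_one_mul S _)
    rcases S.eq_one_or_pt b with rfl | ⟨y, rfl⟩
    · rw [loop_mul_one]
      exact (loop_mul_one T _).symm
    by_cases hne : x = y
    · subst hne
      rw [loop_mul_self]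
      exact (loop_mul_self T _).symm
    · have hm := (h _).1 (S.third_mem hne)
      rw [Set.image_insert_eq, Set.image_insert_eq, Set.image_singleton] at hm
      rw [S.pt_mul_pt hne]
      exact ((mem_triples_iff T).1 hm).2.symm

theorem loopEquiv_one {S : STS α} {T : STS β} (e : S.Loop ≃* T.Loop) : e 1 = 1 :=
  S.isSteinerLoop_loop.map_one T.isSteinerLoop_loop e

theorem image_mem_triples {S : STS α} {T : STS β} (e : S.Loop ≃* T.Loop) (σ : α → β)
    (h : ∀ x, e (S.pt x) = T.pt (σ x)) {t : Set α} (ht : t ∈ S.triples) :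
    σ '' t ∈ T.triples := by
  obtain ⟨x, y, z, rfl⟩ := S.exists_of_mem_triples ht
  obtain ⟨hne, hz⟩ := (mem_triples_iff S).1 ht
  rw [Set.image_insert_eq, Set.image_insert_eq, Set.image_singleton, mem_triples_iff]
  refine ⟨fun e1 => hne ?_, ?_⟩
  · apply S.pt_injective
    apply e.injective
    rw [h, h, e1]
  · rw [← h, ← h, ← h, ← hz, map_mul]

/-- Every isomorphism of Steiner loops comes from an isomorphism of Steiner triple systems. -/
theorem exists_equiv_of_loopEquiv {S : STS α} {T : STS β} (e : S.Loop ≃* T.Loop) :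
    ∃ σ : α ≃ β, (∀ x, e (S.pt x) = T.pt (σ x)) ∧
      ∀ t : Set α, t ∈ S.triples ↔ σ '' t ∈ T.triples := by
  let e' : Option α ≃ Option β := e.toEquiv
  have h1 : ∀ x, e (S.pt x) = T.pt (Equiv.removeNone e' x) := by
    intro x
    refine (Equiv.removeNone_some e' ?_).symm
    have hx : e (S.pt x) ≠ 1 := by
      rw [← loopEquiv_one e]
      exact fun h => S.pt_ne_one x (e.injective h)
    exact Option.ne_none_iff_exists'.1 hx
  have h2 : ∀ y, e.symm (T.pt y) = S.pt ((Equiv.removeNone e').symm y) := by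
    intro y
    rw [MulEquiv.symm_apply_eq, h1, Equiv.apply_symm_apply]
  refine ⟨Equiv.removeNone e', h1, fun t => ⟨image_mem_triples e _ h1, fun ht => ?_⟩⟩
  have := image_mem_triples e.symm _ h2 ht
  rwa [Equiv.symm_image_image] at this

theorem isomorphic_iff {S : STS α} {T : STS β} :
    S.Isomorphic T ↔ Nonempty (S.Loop ≃* T.Loop) := by
  constructor
  · rintro ⟨σ, h⟩
    exact ⟨loopEquivOf σ h⟩
  · rintro ⟨e⟩
    obtain ⟨σ, -, h⟩ := exists_equiv_of_loopEquiv e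
    exact ⟨σ, h⟩

/-- The automorphisms of a system and of its Steiner loop. -/
noncomputable def autEquiv (S : STS α) : S.aut ≃* MulAut S.Loop :=
  MulEquiv.ofBijective
    (⟨⟨fun σ => loopEquivOf σ.1 σ.2, by
      ext a; rcases S.eq_one_or_pt a with rfl | ⟨x, rfl⟩ <;> rfl⟩, by
      intro σ τ; ext a; rcases S.eq_one_or_pt a with rfl | ⟨x, rfl⟩ <;> rfl⟩ :
      S.aut →* MulAut S.Loop)
    (by
      constructor
      · intro σ τ h
        ext x
        exact S.pt_injective (DFunLike.congr_fun h (S.pt x))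
      · intro e
        obtain ⟨σ, h1, h2⟩ := exists_equiv_of_loopEquiv (S := S) (T := S) e
        refine ⟨⟨σ, h2⟩, ?_⟩
        ext a
        rcases S.eq_one_or_pt a with rfl | ⟨x, rfl⟩
        · exact (loopEquiv_one (S := S) (T := S) e).symm
        · exact (h1 x).symm)

theorem autEquiv_pt (S : STS α) (σ : S.aut) (x : α) :
    S.autEquiv σ (S.pt x) = S.pt (σ.1 x) := rfl

/-- Associativity of x with a and b holds in every Steiner loop when one factor is the identity or
when x = a, a = b or x = ab. In the remaining case it is the Veblen condition for the triples
through x and a, through x and ab, and {b, a, ab}. -/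
theorem isVeblen_iff (S : STS α) {x : α} : S.IsVeblen x ↔ S.pt x ∈ Set.center S.Loop := by
  have hL := S.isSteinerLoop_loop
  rw [hL.mem_center]
  constructor
  · intro h a b
    rcases S.eq_one_or_pt a with rfl | ⟨a, rfl⟩
    · rw [hL.one_mul, hL.mul_one]
    rcases S.eq_one_or_pt b with rfl | ⟨b, rfl⟩
    · rw [hL.mul_one, hL.mul_one]
    by_cases hxa : x = a
    · rw [hxa, hL.mul_mul, hL.mul_self, hL.one_mul]
    by_cases hab : a = b
    · rw [hab, hL.mul_self, hL.mul_one, hL.mul_comm _ (S.pt b), hL.mul_comm _ (S.pt b),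
        hL.mul_mul]
    rcases S.eq_one_or_pt (S.pt a * S.pt b) with hu | ⟨u, hu⟩
    · exact absurd (S.pt_injective (hL.mul_eq_one hu)) hab
    by_cases hxu : x = u
    · rw [hu, ← hxu, hL.mul_self, hxu, ← hu, hL.mul_comm _ (S.pt a), hL.mul_mul, hL.mul_self]
    have key := h a (S.third hxa) u (S.third hxu) b (S.third_mem hxa) (S.third_mem hxu)
      ((mem_triples_iff S).2 ⟨Ne.symm hab, by rw [hL.mul_comm, hu]⟩)
    rw [hu, S.pt_mul_pt hxu, S.pt_mul_pt hxa, ← ((mem_triples_iff S).1 key).2, hL.mul_comm]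
  · intro h a b c d t hb hd ht
    obtain ⟨-, hb⟩ := (mem_triples_iff S).1 hb
    obtain ⟨-, hd⟩ := (mem_triples_iff S).1 hd
    obtain ⟨hta, hc⟩ := (mem_triples_iff S).1 ht
    have e1 : S.pt t * S.pt b = S.pt d := by
      rw [← hb, ← hd, ← hc, hL.mul_comm, ← h, hL.mul_comm (S.pt a)]
    refine (mem_triples_iff S).2 ⟨?_, e1⟩
    rintro rfl
    rw [hL.mul_self] at e1
    exact S.pt_ne_one d e1.symm

end STS

/-! ### Centres and central quotients -/

theorem IsSteinerLoop.map_mem_center {L M : Type*} [Mul L] [Mul M] {o : L} {u : M}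
    (h : IsSteinerLoop L o) (k : IsSteinerLoop M u) (e : L ≃* M) {z : L} :
    e z ∈ Set.center M ↔ z ∈ Set.center L := by
  rw [h.mem_center, k.mem_center]
  constructor
  · intro H b c
    apply e.injective
    simpa only [map_mul] using H (e b) (e c)
  · intro H b c
    obtain ⟨b, rfl⟩ := e.surjective b
    obtain ⟨c, rfl⟩ := e.surjective c
    rw [← map_mul, ← map_mul, H, map_mul, map_mul]

/-- A surjective homomorphism whose kernel is the congruence `c` identifies the quotient. -/
noncomputable def Con.quotientEquiv {M N : Type*} [Mul M] [Mul N] (c : Con M) (φ : M → N)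
    (hm : ∀ a b, φ (a * b) = φ a * φ b) (hs : Function.Surjective φ)
    (hk : ∀ a b, c a b ↔ φ a = φ b) : c.Quotient ≃* N where
  toEquiv := Equiv.ofBijective (Quotient.lift φ fun a b h => (hk a b).1 h) (by
    constructor
    · intro a b
      induction a, b using Quotient.inductionOn₂ with
      | h a b => exact fun h => Quotient.sound ((hk a b).2 h)
    · intro n
      obtain ⟨a, rfl⟩ := hs n
      exact ⟨Quotient.mk _ a, rfl⟩)
  map_mul' a b := by
    induction a, b using Quotient.inductionOn₂ with
    | h a b => exact hm a b

theorem ZMod.eq_zero_or_one_of_two (x : ZMod 2) : x = 0 ∨ x = 1 := by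
  revert x; decide

/-- A choice of representatives for a two-to-one map gives coordinates on its domain. -/
theorem bijective_section {L M : Type*} [Mul L] {o z : L} (h : IsSteinerLoop L o) (hz : z ≠ o)
    {φ : L → M} (hφ : ∀ a b, φ a = φ b ↔ b = a ∨ b = a * z) {s : M → L} (hs : ∀ m, φ (s m) = m) :
    Function.Bijective (fun p : M × ZMod 2 => s p.1 * if p.2 = 0 then o else z) := by
  have hz' : ∀ m (x : ZMod 2), φ (s m * if x = 0 then o else z) = m := by
    intro m x
    conv_rhs => rw [← hs m]
    rw [eq_comm, hφ]
    split_ifs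
    · exact Or.inl (h.mul_one _)
    · exact Or.inr rfl
  constructor
  · rintro ⟨m, x⟩ ⟨n, y⟩ e
    have hmn : m = n := by
      have := congrArg φ e
      simpa only [hz'] using this
    subst hmn
    have := h.mul_cancel e
    revert this
    rcases ZMod.eq_zero_or_one_of_two x with rfl | rfl <;>
      rcases ZMod.eq_zero_or_one_of_two y with rfl | rfl <;> simp [hz, hz.symm]
  · intro a
    rcases (hφ (s (φ a)) a).1 (hs _) with e | e
    · exact ⟨(φ a, 0), by simp [h.mul_one, ← e]⟩
    · exact ⟨(φ a, 1), by simp [← e]⟩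

namespace STS

variable {α β : Type*}

theorem isQuotientSystem_iff {S : STS α} {Q : STS β} :
    S.IsQuotientSystem Q ↔ ∃ φ : S.Loop → Q.Loop, (∀ a b, φ (a * b) = φ a * φ b) ∧
      Function.Surjective φ ∧ ∀ a b, φ a = φ b ↔ ∃ z ∈ Set.center S.Loop, b = a * z := by
  constructor
  · rintro ⟨e⟩
    refine ⟨fun a => e (a : S.centerCon.Quotient), fun a b => ?_, ?_, fun a b => ?_⟩
    · rw [← map_mul]
      rfl
    · exact e.surjective.comp Quotient.mk_surjective
    · refine e.injective.eq_iff.trans ?_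
      exact Quotient.eq (r := S.centerCon.toSetoid)
  · rintro ⟨φ, hm, hs, hk⟩
    exact ⟨S.centerCon.quotientEquiv φ hm hs fun a b => (hk a b).symm⟩

theorem hasOneVeblen_iff {S : STS α} :
    S.HasOneVeblen ↔ ∃ z, z ≠ 1 ∧ Set.center S.Loop = {1, z} := by
  have h1 : (1 : S.Loop) ∈ Set.center S.Loop := by
    rw [S.isSteinerLoop_loop.mem_center]
    intro b c
    rw [loop_one_mul, loop_one_mul]
  constructor
  · rintro ⟨x, hx, hu⟩
    refine ⟨S.pt x, S.pt_ne_one x, Set.ext fun a => ?_⟩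
    rw [isVeblen_iff] at hx
    constructor
    · intro ha
      rcases S.eq_one_or_pt a with rfl | ⟨y, rfl⟩
      · exact Or.inl rfl
      · exact Or.inr (congrArg S.pt (hu y (S.isVeblen_iff.2 ha)))
    · rintro (rfl | rfl)
      exacts [h1, hx]
  · rintro ⟨z, hz, hc⟩
    rcases S.eq_one_or_pt z with rfl | ⟨x, rfl⟩
    · exact absurd rfl hz
    · refine ⟨x, S.isVeblen_iff.2 (by rw [hc]; simp), fun y hy => ?_⟩
      have hy := S.isVeblen_iff.1 hy
      rw [hc] at hy
      rcases hy with hy | hy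
      · exact absurd hy (S.pt_ne_one y)
      · exact S.pt_injective hy

/-! ### Central extensions and factor systems -/

section Extension

variable {Q : STS β}

theorem factor_symm (f : Q.factorSystems) (a b : Q.Loop) : f.1 a b = f.1 b a := f.2.1 a b

theorem factor_one (f : Q.factorSystems) (a : Q.Loop) : f.1 a 1 = 0 := f.2.2.1 a

theorem factor_one_left (f : Q.factorSystems) (a : Q.Loop) : f.1 1 a = 0 := by
  rw [factor_symm, factor_one]

theorem factor_self (f : Q.factorSystems) (a : Q.Loop) : f.1 a a = 0 := f.2.2.2.1 a

theorem factor_mul (f : Q.factorSystems) (a b : Q.Loop) : f.1 a (a * b) = f.1 a b := by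
  rcases Q.eq_one_or_pt a with rfl | ⟨x, rfl⟩
  · rw [factor_one_left, factor_one_left]
  rcases Q.eq_one_or_pt b with rfl | ⟨y, rfl⟩
  · rw [loop_mul_one, factor_self, factor_one]
  by_cases h : x = y
  · rw [h, loop_mul_self, factor_self, factor_one]
  · rw [Q.pt_mul_pt h]
    exact (f.2.2.2.2 x y _ (Q.third_mem h)).1.symm

theorem mem_factorSystems {f : Q.Loop → Q.Loop → ZMod 2} (h1 : ∀ a b, f a b = f b a)
    (h2 : ∀ a, f a 1 = 0) (h3 : ∀ a, f a a = 0) (h4 : ∀ a b, f a (a * b) = f a b) :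
    f ∈ Q.factorSystems := by
  refine ⟨h1, h2, h3, fun x y z h => ?_⟩
  obtain ⟨hne, hz⟩ := (mem_triples_iff Q).1 h
  have e1 : f (Q.pt x) (Q.pt y) = f (Q.pt x) (Q.pt z) := by rw [← hz, h4]
  refine ⟨e1, ?_⟩
  rw [← e1, h1, ← h4, Q.isSteinerLoop_loop.mul_comm, hz]

/-- The elements of an extension. -/
def extMk (f : Q.factorSystems) (a : Q.Loop) (x : ZMod 2) : Q.Extension f :=
  ((a, x) : Q.Loop × ZMod 2)

/-- The projection of an extension to the Steiner loop that is extended. -/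
def extFst {f : Q.factorSystems} (p : Q.Extension f) : Q.Loop := Prod.fst p

/-- The second component of an element of an extension. -/
def extSnd {f : Q.factorSystems} (p : Q.Extension f) : ZMod 2 := Prod.snd p

theorem extFst_mk (f : Q.factorSystems) (a : Q.Loop) (x : ZMod 2) : extFst (extMk f a x) = a := rfl

theorem extFst_mul {f : Q.factorSystems} (p q : Q.Extension f) :
    extFst (p * q) = extFst p * extFst q := rfl

theorem extMk_eta {f : Q.factorSystems} (p : Q.Extension f) :
    extMk f (extFst p) (extSnd p) = p := rfl

theorem extMk_mul (f : Q.factorSystems) (a b : Q.Loop) (x y : ZMod 2) :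
    extMk f a x * extMk f b y = extMk f (a * b) (x + y + f.1 a b) := rfl

theorem ext_forall {f : Q.factorSystems} {P : Q.Extension f → Prop}
    (h : ∀ a x, P (extMk f a x)) (p : Q.Extension f) : P p := h p.1 p.2

theorem isSteinerLoop_ext (f : Q.factorSystems) : IsSteinerLoop (Q.Extension f) (extMk f 1 0) := by
  have hL := Q.isSteinerLoop_loop
  refine ⟨ext_forall fun a x => ?_, ext_forall fun a x => ext_forall fun b y => ?_,
    ext_forall fun a x => ?_, ext_forall fun a x => ext_forall fun b y => ?_⟩
  · rw [extMk_mul, loop_one_mul, factor_one_left, zero_add, add_zero]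
  · rw [extMk_mul, extMk_mul, hL.mul_comm, factor_symm, add_comm x]
  · rw [extMk_mul, loop_mul_self, factor_self, CharTwo.add_self_eq_zero, add_zero]
  · rw [extMk_mul, extMk_mul, hL.mul_mul, factor_mul]
    congr 1
    linear_combination (CharTwo.add_self_eq_zero x) + (CharTwo.add_self_eq_zero (f.1 a b))

/-- The projection of a central element is central in the base loop, hence trivial; over the
identity the factor system vanishes, so the fibre associates with everything. -/
theorem center_ext (hQ : Set.center Q.Loop = {1}) {f : Q.factorSystems} (p : Q.Extension f) :
    p ∈ Set.center (Q.Extension f) ↔ extFst p = 1 := by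
  rw [(isSteinerLoop_ext f).mem_center]
  constructor
  · intro h
    have : extFst p ∈ Set.center Q.Loop := by
      rw [Q.isSteinerLoop_loop.mem_center]
      intro b c
      exact congrArg extFst (h (extMk f b 0) (extMk f c 0))
    rwa [hQ] at this
  · revert p
    refine ext_forall fun a x (ha : a = 1) => ?_
    subst ha
    refine ext_forall fun b y => ext_forall fun c z => ?_
    simp only [extMk_mul, loop_one_mul, factor_one_left]
    congr 1
    ring

/-- A section s of the central quotient fails to be multiplicative by a central element only,
s(a)s(b) = s(ab)w(f(a, b)); the identities of Steiner loops make this f a factor system. -/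
theorem exists_extension {S : STS α} (h : HasOneVeblenOver Q S) :
    ∃ f : Q.factorSystems, Nonempty (S.Loop ≃* Q.Extension f) := by
  classical
  obtain ⟨h1, h2⟩ := h
  obtain ⟨z, hz, hc⟩ := hasOneVeblen_iff.1 h1
  obtain ⟨φ, hm, hs, hk⟩ := isQuotientSystem_iff.1 h2
  have hS := S.isSteinerLoop_loop
  have hT := Q.isSteinerLoop_loop
  have hk' : ∀ a b, φ a = φ b ↔ b = a ∨ b = a * z := by
    intro a b
    rw [hk, hc]
    simp [hS.mul_one]
  have hzc : z ∈ Set.center S.Loop := by rw [hc]; simp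
  have hφ1 : φ 1 = 1 := by
    have := hm 1 1
    rwa [hS.mul_self, hT.mul_self] at this
  obtain ⟨s, hs1, hs⟩ : ∃ s : Q.Loop → S.Loop, s 1 = 1 ∧ ∀ q, φ (s q) = q := by
    -- The section is normalised at the identity, so that f(a, 1) = f(a, a) = 0.
    refine ⟨Function.update (Function.surjInv hs) 1 1, by simp, fun q => ?_⟩
    by_cases hq : q = 1
    · rw [hq, Function.update_self, hφ1]
    · rw [Function.update_of_ne hq]; exact Function.surjInv_eq hs q
  let w : ZMod 2 → S.Loop := fun x => if x = 0 then 1 else z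
  have hw : ∀ x, w x ∈ Set.center S.Loop := by
    intro x
    rw [hc]
    by_cases hx : x = 0 <;> simp [w, hx]
  have hww : ∀ x y, w x * w y = w (x + y) := by
    intro x y
    have h2 : (1 + 1 : ZMod 2) = 0 := by decide
    rcases ZMod.eq_zero_or_one_of_two x with rfl | rfl <;>
      rcases ZMod.eq_zero_or_one_of_two y with rfl | rfl <;>
      simp [w, hS.one_mul, hS.mul_one, hS.mul_self, h2]
  have hw0 : w 0 = 1 := by simp [w]
  have hwi : Function.Injective w := by
    intro x y
    rcases ZMod.eq_zero_or_one_of_two x with rfl | rfl <;>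
      rcases ZMod.eq_zero_or_one_of_two y with rfl | rfl <;> simp [w, hz, hz.symm]
  have hsw : ∀ a b, ∃ x, s a * s b = s (a * b) * w x := by
    intro a b
    have : φ (s (a * b)) = φ (s a * s b) := by rw [hm, hs, hs, hs]
    rcases (hk' _ _).1 this with e | e
    · exact ⟨0, by rw [e, hw0, hS.mul_one]⟩
    · exact ⟨1, by rw [e]; simp [w]⟩
  choose f hf using hsw
  have huniq : ∀ {a b x}, s a * s b = s (a * b) * w x → f a b = x := fun {a b x} e =>
    hwi (hS.mul_cancel ((hf a b).symm.trans e))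
  have hfs : f ∈ Q.factorSystems := by
    refine mem_factorSystems ?_ ?_ ?_ ?_
    · intro a b
      exact huniq (by rw [hS.mul_comm, hf, hT.mul_comm])
    · intro a
      exact huniq (by rw [hs1, hT.mul_one, hw0])
    · intro a
      exact huniq (by rw [hS.mul_self, hT.mul_self, hs1, hw0, hS.mul_one])
    · intro a b
      apply huniq
      have e1 := (hw (f a b)).right_assoc
      rw [hT.mul_mul]
      -- Since `w (f a b)` is central and its own inverse, the defining relation can be solved for
      -- `s (a * b)`; multiplying by `s a` then gives f(a, ab) = f(a, b).
      have : s (a * b) = s a * s b * w (f a b) := by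
        rw [hf, e1, hS.mul_self, hS.mul_one]
      rw [this, e1, hS.mul_mul]
  have hbij : Function.Bijective (fun p : Q.Extension ⟨f, hfs⟩ => s (extFst p) * w (extSnd p)) :=
    bijective_section hS hz hk' hs
  refine ⟨⟨f, hfs⟩, ⟨((MulEquiv.ofBijective (⟨_, ?_⟩ :
    Q.Extension ⟨f, hfs⟩ →ₙ* S.Loop)) hbij).symm⟩⟩
  refine ext_forall fun a x => ext_forall fun b y => ?_
  change s (a * b) * w (x + y + f a b) = (s a * w x) * (s b * w y)
  rw [← (hw y).right_assoc, hS.mul_comm (s a), ← (hw x).left_assoc, hf, hS.mul_comm (w x),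
    (hw x).right_assoc, (hw y).right_assoc, hww, hww]
  congr 2
  ring

theorem hasOneVeblenOver_of_extension (hQ : Set.center Q.Loop = {1}) {S : STS α}
    (f : Q.factorSystems) (e : S.Loop ≃* Q.Extension f) : HasOneVeblenOver Q S := by
  have hS := S.isSteinerLoop_loop
  have hE := isSteinerLoop_ext f
  have he1 : e 1 = extMk f 1 0 := hS.map_one hE e
  have hcen : ∀ a, a ∈ Set.center S.Loop ↔ extFst (e a) = 1 := by
    intro a
    rw [← hS.map_mem_center hE e, center_ext hQ]
  refine ⟨hasOneVeblen_iff.2 ⟨e.symm (extMk f 1 1), ?_, ?_⟩,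
    isQuotientSystem_iff.2 ⟨fun a => extFst (e a), ?_, ?_, ?_⟩⟩
  · intro h
    rw [MulEquiv.symm_apply_eq, he1] at h
    exact absurd (congrArg extSnd h) (by decide : (1 : ZMod 2) ≠ 0)
  · ext a
    rw [hcen]
    constructor
    · intro h
      rcases ZMod.eq_zero_or_one_of_two (extSnd (e a)) with h2 | h2
      · left
        apply e.injective
        rw [he1, ← extMk_eta (e a), h, h2]
      · right
        rw [Set.mem_singleton_iff, MulEquiv.eq_symm_apply, ← extMk_eta (e a), h, h2]
    · rintro (rfl | rfl)
      · rw [he1, extFst_mk]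
      · rw [MulEquiv.apply_symm_apply, extFst_mk]
  · intro a b
    change extFst (e (a * b)) = _
    rw [map_mul, extFst_mul]
  · intro q
    exact ⟨e.symm (extMk f q 0), by simp only [MulEquiv.apply_symm_apply, extFst_mk]⟩
  · intro a b
    constructor
    · intro h
      -- Elements are their own inverses, so the quotient of `a` and `b` is `a * b`, and it lies
      -- over the identity.
      refine ⟨a * b, (hcen _).2 ?_, (hS.mul_mul a b).symm⟩
      have h : extFst (e a) = extFst (e b) := h
      rw [map_mul, extFst_mul, h, loop_mul_self]
    · rintro ⟨z, hz, rfl⟩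
      change _ = extFst (e (a * z))
      rw [map_mul, extFst_mul, (hcen z).1 hz, loop_mul_one]

theorem extOrbit_eq_iff (f g : Q.factorSystems) :
    Q.extOrbit f = Q.extOrbit g ↔ ∃ (b : MulAut Q.Loop) (φ : Q.Loop → ZMod 2), φ 1 = 0 ∧
      ∀ P R, f.1 P R = g.1 (b P) (b R) + (φ P + φ R - φ (P * R)) := by
  have h1 : Q.extOrbit f = Q.extOrbit g ↔ ∃ b : MulAut Q.Loop,
      (QuotientAddGroup.mk (b • g) : Q.ExtClasses) = QuotientAddGroup.mk f :=
    (Quotient.eq (r := MulAction.orbitRel (MulAut Q.Loop) Q.ExtClasses)).trans Iff.rfl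
  have h2 : ∀ b : MulAut Q.Loop, (QuotientAddGroup.mk (b • g) : Q.ExtClasses) =
      QuotientAddGroup.mk f ↔ ∃ φ : Q.Loop → ZMod 2, φ 1 = 0 ∧
      ∀ P R, f.1 P R = g.1 (b⁻¹ P) (b⁻¹ R) + (φ P + φ R - φ (P * R)) := by
    intro b
    rw [QuotientAddGroup.eq, AddSubgroup.mem_addSubgroupOf]
    refine exists_congr fun φ => and_congr_right fun _ => forall_congr' fun P =>
      forall_congr' fun R => ?_
    change -(g.1 (b⁻¹ P) (b⁻¹ R)) + f.1 P R = _ ↔ _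
    rw [neg_add_eq_iff_eq_add]
  rw [h1]
  simp only [h2]
  -- The action involves inverses; as `b` runs through a group, they can be dropped.
  exact ⟨fun ⟨b, h⟩ => ⟨b⁻¹, h⟩, fun ⟨b, h⟩ => ⟨b⁻¹, by rwa [inv_inv]⟩⟩

theorem extension_equiv_of_extOrbit_eq {f g : Q.factorSystems} (h : Q.extOrbit f = Q.extOrbit g) :
    Nonempty (Q.Extension f ≃* Q.Extension g) := by
  obtain ⟨b, φ, -, h⟩ := (extOrbit_eq_iff f g).1 h
  refine ⟨MulEquiv.ofBijective (⟨fun p => ((b p.1, p.2 + φ p.1) : Q.Loop × ZMod 2), ?_⟩ :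
    Q.Extension f →ₙ* Q.Extension g) ⟨?_, ?_⟩⟩
  · rintro ⟨P, x⟩ ⟨R, y⟩
    change ((b (P * R), x + y + f.1 P R + φ (P * R)) : Q.Loop × ZMod 2) =
      (b P * b R, x + φ P + (y + φ R) + g.1 (b P) (b R))
    rw [map_mul, h]
    congr 1
    ring
  · rintro ⟨P, x⟩ ⟨R, y⟩ e
    have e1 : P = R := b.injective (congrArg Prod.fst e)
    subst e1
    have e2 : x + φ P = y + φ P := congrArg Prod.snd e
    rw [add_right_cancel e2]
  · rintro ⟨P, x⟩
    refine ⟨((b.symm P, x - φ (b.symm P)) : Q.Loop × ZMod 2), ?_⟩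
    change ((b (b.symm P), x - φ (b.symm P) + φ (b.symm P)) : Q.Loop × ZMod 2) = (P, x)
    rw [MulEquiv.apply_symm_apply, sub_add_cancel]

/-- The centre is the fibre over the identity, so its only nontrivial element is preserved. Hence
the isomorphism respects fibres and equals (P, x) ↦ (bP, φ(P) + x); comparing second components of
products shows that f and the pullback of g differ by the coboundary of φ. -/
theorem extOrbit_eq_of_extension_equiv (hQ : Set.center Q.Loop = {1}) {f g : Q.factorSystems}
    (e : Q.Extension f ≃* Q.Extension g) : Q.extOrbit f = Q.extOrbit g := by
  have hf := isSteinerLoop_ext f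
  have hg := isSteinerLoop_ext g
  let i := extMk f
  let j := extMk g
  let b : Q.Loop → Q.Loop := fun P => extFst (e (i P 0))
  let φ : Q.Loop → ZMod 2 := fun P => extSnd (e (i P 0))
  have h0 : e (i 1 0) = j 1 0 := hf.map_one hg e
  have h1 : e (i 1 1) = j 1 1 := by
    have hc1 : extFst (e (i 1 1)) = 1 :=
      (center_ext hQ _).1 ((hf.map_mem_center hg e).2 ((center_ext hQ _).2 rfl))
    have he := extMk_eta (e (i 1 1))
    rw [hc1] at he
    rcases ZMod.eq_zero_or_one_of_two (extSnd (e (i 1 1))) with h2 | h2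
    · rw [h2] at he
      have := e.injective (h0.trans he)
      exact absurd (congrArg extSnd this) (by decide : (0 : ZMod 2) ≠ 1)
    · rw [h2] at he
      exact he.symm
  have hx : ∀ P x, e (i P x) = j (b P) (φ P + x) := by
    intro P x
    have hi : i P x = i P 0 * i 1 x := by
      rw [extMk_mul, loop_mul_one, factor_one, zero_add, add_zero]
    have hx1 : e (i 1 x) = j 1 x := by
      rcases ZMod.eq_zero_or_one_of_two x with rfl | rfl
      exacts [h0, h1]
    rw [hi, map_mul, hx1, ← extMk_eta (e (i P 0)), extMk_mul, loop_mul_one, factor_one, add_zero]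
  have hmul : ∀ P R, j (b (P * R)) (φ (P * R) + f.1 P R) =
      j (b P * b R) (φ P + φ R + g.1 (b P) (b R)) := by
    intro P R
    rw [← hx]
    have : i (P * R) (f.1 P R) = i P 0 * i R 0 := by
      rw [extMk_mul, zero_add, zero_add]
    rw [this, map_mul]
    rfl
  have hbm : ∀ P R, b (P * R) = b P * b R := fun P R => congrArg extFst (hmul P R)
  have hbij : Function.Bijective b := by
    constructor
    · intro P R h
      -- The second component `φ P` is chosen so that the image has second component φ(P) + φ(P) =
      -- 0.
      have : e (i P (φ P)) = e (i R (φ R)) := by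
        rw [hx, hx, h, CharTwo.add_self_eq_zero, CharTwo.add_self_eq_zero]
      exact congrArg extFst (e.injective this)
    · intro P
      obtain ⟨p, hR⟩ := e.surjective (j P 0)
      have := (hx (extFst p) (extSnd p)).symm.trans hR
      exact ⟨extFst p, congrArg extFst this⟩
  refine (extOrbit_eq_iff f g).2
    ⟨MulEquiv.ofBijective (⟨b, hbm⟩ : Q.Loop →ₙ* Q.Loop) hbij, φ, ?_, fun P R => ?_⟩
  · exact congrArg extSnd h0
  · have h2 : φ (P * R) + f.1 P R = φ P + φ R + g.1 (b P) (b R) := congrArg extSnd (hmul P R)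
    change f.1 P R = g.1 (b P) (b R) + (φ P + φ R - φ (P * R))
    linear_combination h2

end Extension

/-! ### Isomorphism classes of STS(27)s and orbits of extension classes -/

theorem exists_system_of_extension {Q : STS (Fin 13)} (f : Q.factorSystems) :
    ∃ S : STS (Fin 27), Nonempty (S.Loop ≃* Q.Extension f) := by
  refine exists_loop_equiv (isSteinerLoop_ext f) ?_
  change Nat.card (Q.Loop × ZMod 2) = _
  rw [Nat.card_prod, card_loop, Nat.card_fin, Nat.card_zmod]

/-- A relation that matches the fibres of two surjections induces a bijection of their targets. -/
theorem exists_equiv_of_rel {F Y X Z : Type*} {p : F → X} {q : Y → Z}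
    (hp : Function.Surjective p) (hq : Function.Surjective q) (R : F → Y → Prop)
    (h1 : ∀ f, ∃ y, R f y) (h2 : ∀ y, ∃ f, R f y)
    (h3 : ∀ f y f' y', R f y → R f' y' → (p f = p f' ↔ q y = q y'))
    (h4 : ∀ f y y', q y = q y' → R f y → R f y') :
    ∃ e : X ≃ Z, ∀ f y, e (p f) = q y ↔ R f y := by
  choose r hr using h1
  have key : ∀ f y, q (r f) = q y ↔ R f y := fun f y =>
    ⟨fun h => h4 f _ _ h (hr f), fun h => (h3 f _ f y (hr f) h).1 rfl⟩
  have hsec : ∀ f, q (r (Function.surjInv hp (p f))) = q (r f) := fun f =>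
    (h3 _ _ _ _ (hr _) (hr _)).1 (Function.surjInv_eq hp _)
  refine ⟨Equiv.ofBijective (fun x => q (r (Function.surjInv hp x))) ⟨?_, ?_⟩, fun f y => ?_⟩
  · intro x x' h
    have := (h3 _ _ _ _ (hr _) (hr _)).2 h
    rwa [Function.surjInv_eq hp, Function.surjInv_eq hp] at this
  · intro z
    obtain ⟨y, rfl⟩ := hq z
    obtain ⟨f, hf⟩ := h2 y
    exact ⟨p f, (hsec f).trans ((key f y).2 hf)⟩
  · exact (Eq.congr_left (hsec f)).trans (key f y)

theorem classesCorrespondToOrbits {Q : STS (Fin 13)} (hQ : Set.center Q.Loop = {1}) :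
    Q.ClassesCorrespondToOrbits := by
  refine exists_equiv_of_rel (p := Q.extOrbit)
    (q := fun S : {S : STS (Fin 27) // HasOneVeblenOver Q S} =>
      (Quotient.mk (isoSetoid 27 (HasOneVeblenOver Q)) S))
    (Quotient.mk_surjective.comp (QuotientAddGroup.mk_surjective)) Quotient.mk_surjective
    (fun f S => Nonempty (S.1.Loop ≃* Q.Extension f)) ?_ ?_ ?_ ?_
  · intro f
    obtain ⟨S, ⟨e⟩⟩ := exists_system_of_extension f
    exact ⟨⟨S, hasOneVeblenOver_of_extension hQ f e⟩, ⟨e⟩⟩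
  · exact fun S => exists_extension S.2
  · rintro f S f' S' ⟨e⟩ ⟨e'⟩
    rw [Quotient.eq (r := isoSetoid 27 (HasOneVeblenOver Q))]
    refine Iff.trans ?_ isomorphic_iff.symm
    constructor
    · intro h
      obtain ⟨k⟩ := extension_equiv_of_extOrbit_eq h
      exact ⟨(e.trans k).trans e'.symm⟩
    · rintro ⟨k⟩
      exact extOrbit_eq_of_extension_equiv hQ ((e.symm.trans k).trans e')
  · rintro f S S' h ⟨e⟩
    obtain ⟨k⟩ := isomorphic_iff.1 ((Quotient.eq (r := isoSetoid 27 (HasOneVeblenOver Q))).1 h)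
    exact ⟨k.symm.trans e⟩

theorem exists_quotientSystem {S : STS (Fin 27)} (h : S.HasOneVeblen) :
    ∃ Q : STS (Fin 13), S.IsQuotientSystem Q := by
  obtain ⟨z, hz, hc⟩ := hasOneVeblen_iff.1 h
  have hS := S.isSteinerLoop_loop
  have hL : IsSteinerLoop S.centerCon.Quotient (Quotient.mk _ (1 : S.Loop)) := by
    refine ⟨fun a => ?_, fun a b => ?_, fun a => ?_, fun a b => ?_⟩
    · induction a using Quotient.inductionOn with
      | h a => exact congrArg _ (hS.one_mul a)
    · induction a, b using Quotient.inductionOn₂ with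
      | h a b => exact congrArg _ (hS.mul_comm a b)
    · induction a using Quotient.inductionOn with
      | h a => exact congrArg _ (hS.mul_self a)
    · induction a, b using Quotient.inductionOn₂ with
      | h a b => exact congrArg _ (hS.mul_mul a b)
  have hφ : ∀ a b : S.Loop, (Quotient.mk S.centerCon.toSetoid a) = Quotient.mk _ b ↔
      b = a ∨ b = a * z := by
    intro a b
    rw [Quotient.eq (r := S.centerCon.toSetoid)]
    change (∃ z ∈ Set.center S.Loop, b = a * z) ↔ _
    rw [hc]
    simp [hS.mul_one]
  have hcard : Nat.card S.centerCon.Quotient = 13 + 1 := by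
    -- The classes of the congruence have two elements each, so 28 elements give 14 classes.
    have h1 := Nat.card_congr (Equiv.ofBijective _
      (bijective_section hS hz hφ (fun q => Quotient.out_eq q)))
    have h2 : Nat.card (S.centerCon.Quotient × ZMod 2) = Nat.card S.Loop := h1
    rw [Nat.card_prod, card_loop, Nat.card_fin, Nat.card_zmod] at h2
    omega
  obtain ⟨Q, ⟨e⟩⟩ := exists_loop_equiv hL hcard
  exact ⟨Q, ⟨e.symm⟩⟩

end STS

/-! ### Linear relations between bit vectors, by elimination -/

namespace XorCount

/-- The `j`-th binary digit of `n`, as an element of the field with two elements. -/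
def bit (n j : ℕ) : ZMod 2 := if n.testBit j then 1 else 0

theorem bit_xor (a b j : ℕ) : bit (a ^^^ b) j = bit a j + bit b j := by
  have h2 : (0 : ZMod 2) = 1 + 1 := by decide
  simp only [bit, Nat.testBit_xor]
  cases a.testBit j <;> cases b.testBit j <;> simp [h2]

theorem bit_injective {a b : ℕ} (h : ∀ j, bit a j = bit b j) : a = b := by
  refine Nat.eq_of_testBit_eq fun j => ?_
  have := h j
  simp only [bit] at this
  revert this
  cases a.testBit j <;> cases b.testBit j <;> simp

/-- The number of sublists of a list of numbers whose bitwise sum is `t`. -/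
def count : List ℕ → ℕ → ℕ
  | [], t => if t = 0 then 1 else 0
  | c :: cs, t => count cs t + count cs (t ^^^ c)

open Classical in
-- Splitting on the first coefficient reproduces the recursion of `count`: coefficient 1 moves the
-- first column to the right-hand side.
theorem sum_solutions {n : ℕ} (c : Fin n → ℕ) (t : ℕ) :
    ∑ x : Fin n → ZMod 2, (if ∀ j, ∑ i, x i * bit (c i) j = bit t j then 1 else 0) =
      count (List.ofFn c) t := by
  induction n generalizing t with
  | zero =>
    have : (∀ j, (0 : ZMod 2) = bit t j) ↔ t = 0 := by
      refine ⟨fun h => bit_injective fun j => ?_, fun h j => by simp [h, bit]⟩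
      rw [← h j]
      simp [bit]
    simp [count, this]
  | succ n ih =>
    rw [← Fintype.sum_equiv (Fin.consEquiv fun _ => ZMod 2) _ _ (fun _ => rfl),
      Fintype.sum_prod_type, List.ofFn_succ, count, ← ih, ← ih]
    have h2 : ∀ F : ZMod 2 → ℕ, ∑ x, F x = F 0 + F 1 := Fin.sum_univ_two
    rw [h2]
    congr 1
    · refine Finset.sum_congr rfl fun x _ => ?_
      refine if_congr (forall_congr' fun j => ?_) rfl rfl
      simp [Fin.consEquiv, Fin.sum_univ_succ]
    · refine Finset.sum_congr rfl fun x _ => ?_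
      refine if_congr (forall_congr' fun j => ?_) rfl rfl
      simp only [Fin.consEquiv, Fin.sum_univ_succ, Equiv.coe_fn_mk, Fin.cons_zero, Fin.cons_succ,
        one_mul, bit_xor]
      constructor
      · intro h
        linear_combination h - CharTwo.add_self_eq_zero (bit (c 0) j)
      · intro h
        linear_combination h + CharTwo.add_self_eq_zero (bit (c 0) j)

theorem card_solutions {n : ℕ} (c : Fin n → ℕ) :
    Nat.card {x : Fin n → ZMod 2 // ∀ j, ∑ i, x i * bit (c i) j = 0} =
      count (List.ofFn c) 0 := by
  classical
  rw [← sum_solutions, Nat.card_eq_fintype_card, Fintype.card_subtype, Finset.card_filter]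
  simp [bit]

/-- Elimination of the digit `b` by means of `c`. -/
def reduce (b c d : ℕ) : ℕ := if d.testBit b then d ^^^ c else d

theorem reduce_xor (b c d e : ℕ) :
    reduce b c (d ^^^ e) = reduce b c d ^^^ reduce b c e := by
  refine Nat.eq_of_testBit_eq fun j => ?_
  simp only [reduce, Nat.testBit_xor]
  cases d.testBit b <;> cases e.testBit b <;> simp [Nat.testBit_xor] <;>
    cases d.testBit j <;> cases e.testBit j <;> cases c.testBit j <;> rfl

/-- The left side counts sublists with sum in the coset {t, t + c}. Each coset of {0, c} has exactly
one member whose digit `b` is zero, so `reduce b c` realises the quotient by c. -/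
theorem count_reduce {b c : ℕ} (h : c.testBit b = true) (cs : List ℕ) (t : ℕ) :
    count cs t + count cs (t ^^^ c) = count (cs.map (reduce b c)) (reduce b c t) := by
  induction cs generalizing t with
  | nil =>
    simp only [count, List.map_nil, reduce]
    cases ht : t.testBit b
    · have : t ^^^ c ≠ 0 := by
        intro e
        have := congrArg (Nat.testBit · b) e
        simp [Nat.testBit_xor, ht, h] at this
      simp [this]
    · have : t ≠ 0 := by
        rintro rfl
        simp at ht
      simp [this]
  | cons d cs ih =>
    have hc : t ^^^ c ^^^ d = t ^^^ d ^^^ c := Nat.xor_right_comm t c d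
    rw [List.map_cons, count, count, count, ← reduce_xor, ← ih, ← ih, hc]
    ring

/-- The dimension of the space of linear relations between the numbers of a list, regarded as
binary vectors. The first argument bounds the length of the list. -/
def relDim : ℕ → List ℕ → ℕ
  | 0, _ => 0
  | _ + 1, [] => 0
  | n + 1, c :: cs =>
    if c = 0 then relDim n cs + 1 else relDim n (cs.map (reduce c.log2 c))

/-- A zero vector may be used or not, which doubles the count; a nonzero one is a pivot for its
highest digit and is eliminated from the rest. -/
theorem count_eq (n : ℕ) (cs : List ℕ) (h : cs.length ≤ n) : count cs 0 = 2 ^ relDim n cs := by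
  induction n generalizing cs with
  | zero =>
    rw [List.eq_nil_of_length_eq_zero (Nat.le_zero.1 h)]
    rfl
  | succ n ih =>
    cases cs with
    | nil => rfl
    | cons c cs =>
      rw [List.length_cons, Nat.add_le_add_iff_right] at h
      rw [relDim, count]
      split_ifs with hc
      · rw [hc, Nat.xor_zero, ih cs h, pow_succ, mul_two]
      · rw [count_reduce (Nat.testBit_log2 hc), ← ih _ (by rwa [List.length_map])]
        simp [reduce]

theorem card_solutions_eq {n : ℕ} (c : Fin n → ℕ) :
    Nat.card {x : Fin n → ZMod 2 // ∀ j, ∑ i, x i * bit (c i) j = 0} =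
      2 ^ relDim n (List.ofFn c) := by
  rw [card_solutions, count_eq n _ (by rw [List.length_ofFn])]

end XorCount

/-! ### Counting extension classes and their orbits -/

namespace STS

/-- A product of points whose Steiner triple system has its triples numbered: `blk x y` is the
number of the triple through `x` and `y`, and `fst j`, `snd j` are two points of the triple with
number `j`. -/
structure Numbering {n N : ℕ} (m : Fin n → Fin n → Fin n) (blk : Fin n → Fin n → Fin N)
    (fst snd : Fin N → Fin n) : Prop where
  self : ∀ x, m x x = x
  comm : ∀ x y, m x y = m y x
  mul_mul : ∀ x y, m x (m x y) = y
  blk_comm : ∀ x y, blk x y = blk y x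
  blk_mul : ∀ x y, x ≠ y → blk x (m x y) = blk x y
  fst_ne : ∀ j, fst j ≠ snd j
  blk_fst : ∀ j, blk (fst j) (snd j) = j
  mem_blk : ∀ x y, x ≠ y → x = fst (blk x y) ∨ x = snd (blk x y) ∨
    x = m (fst (blk x y)) (snd (blk x y))

namespace Numbering

variable {n N : ℕ} {m : Fin n → Fin n → Fin n} {blk : Fin n → Fin n → Fin N}
  {fst snd : Fin N → Fin n} (h : Numbering m blk fst snd)

/-- The Steiner triple system of a numbering. -/
def sys (h : Numbering m blk fst snd) : STS (Fin n) := ofProd m h.self h.comm h.mul_mul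

theorem pt_mul {x y : Fin n} (hne : x ≠ y) : h.sys.pt x * h.sys.pt y = h.sys.pt (m x y) :=
  ofProd_mul m h.self h.comm h.mul_mul hne

/-- A factor system is determined by its values on the triples. -/
theorem factor_blk (f : h.sys.factorSystems) {x y : Fin n} (hne : x ≠ y) :
    f.1 (h.sys.pt x) (h.sys.pt y) =
      f.1 (h.sys.pt (fst (blk x y))) (h.sys.pt (snd (blk x y))) := by
  have h1 : ∀ a b, a ≠ b →
      f.1 (h.sys.pt a) (h.sys.pt (m a b)) = f.1 (h.sys.pt a) (h.sys.pt b) := by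
    intro a b hab
    rw [← h.pt_mul hab, factor_mul]
  have hj := h.fst_ne (blk x y)
  have h2 := h1 _ _ hj
  have h3 := h1 _ _ hj.symm
  rw [h.comm, factor_symm f _ (h.sys.pt (fst _))] at h3
  have hx := h.mem_blk x y hne
  have hy := h.mem_blk y x hne.symm
  rw [h.blk_comm] at hy
  generalize blk x y = j at *
  rcases hx with rfl | rfl | rfl <;> rcases hy with rfl | rfl | rfl <;>
    first
    | exact absurd rfl hne
    | rfl
    | assumption
    | (rw [factor_symm]; assumption)
    | exact factor_symm _ _ _

/-- The function on the loop with given values on the triples. -/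
def factorFun (blk : Fin n → Fin n → Fin N) (v : Fin N → ZMod 2) :
    Option (Fin n) → Option (Fin n) → ZMod 2
  | some x, some y => if x = y then 0 else v (blk x y)
  | _, _ => 0

theorem factorFun_mem (v : Fin N → ZMod 2) :
    (factorFun blk v : h.sys.Loop → h.sys.Loop → ZMod 2) ∈ h.sys.factorSystems := by
  have h1 : ∀ a : h.sys.Loop,
      (factorFun blk v : h.sys.Loop → h.sys.Loop → ZMod 2) a (1 : h.sys.Loop) = 0 := by
    intro a
    rcases h.sys.eq_one_or_pt a with rfl | ⟨x, rfl⟩ <;> rfl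
  have h1' : ∀ a : h.sys.Loop,
      (factorFun blk v : h.sys.Loop → h.sys.Loop → ZMod 2) (1 : h.sys.Loop) a = 0 := fun a => rfl
  have h2 : ∀ a : h.sys.Loop,
      (factorFun blk v : h.sys.Loop → h.sys.Loop → ZMod 2) a a = 0 := by
    intro a
    rcases h.sys.eq_one_or_pt a with rfl | ⟨x, rfl⟩
    · rfl
    · exact if_pos rfl
  refine mem_factorSystems (fun a b => ?_) h1 h2 (fun a b => ?_)
  · rcases h.sys.eq_one_or_pt a with rfl | ⟨x, rfl⟩
    · rw [h1, h1']
    rcases h.sys.eq_one_or_pt b with rfl | ⟨y, rfl⟩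
    · rw [h1, h1']
    change (if x = y then 0 else v (blk x y)) = if y = x then 0 else v (blk y x)
    rw [h.blk_comm]
    exact if_congr eq_comm rfl rfl
  · rcases h.sys.eq_one_or_pt a with rfl | ⟨x, rfl⟩
    · rw [h1', h1']
    rcases h.sys.eq_one_or_pt b with rfl | ⟨y, rfl⟩
    · rw [loop_mul_one, h1, h2]
    by_cases hne : x = y
    · rw [hne, loop_mul_self, h1, h2]
    · rw [h.pt_mul hne]
      have : x ≠ m x y := fun e => hne (by rw [← h.mul_mul x y, ← e, h.self])
      change (if x = m x y then 0 else v (blk x (m x y))) = if x = y then 0 else v (blk x y)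
      rw [if_neg this, if_neg hne, h.blk_mul x y hne]

theorem factor_ext {f g : h.sys.factorSystems}
    (e : ∀ j, f.1 (h.sys.pt (fst j)) (h.sys.pt (snd j)) =
      g.1 (h.sys.pt (fst j)) (h.sys.pt (snd j))) : f = g := by
  apply Subtype.ext
  funext a b
  rcases h.sys.eq_one_or_pt a with rfl | ⟨x, rfl⟩
  · rw [factor_one_left, factor_one_left]
  rcases h.sys.eq_one_or_pt b with rfl | ⟨y, rfl⟩
  · rw [factor_one, factor_one]
  by_cases hne : x = y
  · rw [hne, factor_self, factor_self]
  · rw [h.factor_blk f hne, h.factor_blk g hne, e]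

/-- Factor systems are arbitrary functions on the triples. -/
def factorEquiv : (Fin N → ZMod 2) ≃ h.sys.factorSystems where
  toFun v := ⟨factorFun blk v, h.factorFun_mem v⟩
  invFun f j := f.1 (h.sys.pt (fst j)) (h.sys.pt (snd j))
  left_inv v := by
    funext j
    change (if fst j = snd j then 0 else v (blk (fst j) (snd j))) = v j
    rw [if_neg (h.fst_ne j), h.blk_fst]
  right_inv f := h.factor_ext fun j => by
    change (if fst j = snd j then 0 else f.1 (h.sys.pt (fst (blk (fst j) (snd j)))) _) = _
    rw [if_neg (h.fst_ne j), h.blk_fst]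

theorem factorEquiv_apply (v : Fin N → ZMod 2) {x y : Fin n} (hne : x ≠ y) :
    (h.factorEquiv v).1 (h.sys.pt x) (h.sys.pt y) = v (blk x y) := if_neg hne

/-- In characteristic two a coboundary at two points is the sum over their triple. It is itself a
factor system, so testing one pair per triple suffices. -/
theorem mem_coboundaries_iff (f : h.sys.factorSystems) :
    f ∈ h.sys.coboundaries.addSubgroupOf h.sys.factorSystems ↔ ∃ u : Fin n → ZMod 2, ∀ j,
      f.1 (h.sys.pt (fst j)) (h.sys.pt (snd j)) = u (fst j) + u (snd j) + u (m (fst j) (snd j)) := by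
  constructor
  · rintro ⟨φ, -, hφ⟩
    refine ⟨fun x => φ (h.sys.pt x), fun j => ?_⟩
    refine (hφ _ _).trans ?_
    rw [h.pt_mul (h.fst_ne j), CharTwo.sub_eq_add]
  · rintro ⟨u, hu⟩
    let φ : h.sys.Loop → ZMod 2 := fun a => Option.elim a 0 u
    have hφ1 : φ 1 = 0 := rfl
    have hS := h.sys.isSteinerLoop_loop
    have hδ : (fun a b => φ a + φ b - φ (a * b)) ∈ h.sys.factorSystems := by
      refine mem_factorSystems (fun a b => ?_) (fun a => ?_) (fun a => ?_) (fun a b => ?_)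
      · simp only [hS.mul_comm a b, add_comm]
      · simp only [hS.mul_one, hφ1, add_zero, sub_self]
      · simp only [hS.mul_self, hφ1, CharTwo.add_self_eq_zero, sub_zero]
      · simp only [hS.mul_mul, CharTwo.sub_eq_add]
        ring
    have hf : f = ⟨_, hδ⟩ := h.factor_ext fun j => by
      rw [hu]
      change _ = φ _ + φ _ - φ (h.sys.pt (fst j) * h.sys.pt (snd j))
      rw [h.pt_mul (h.fst_ne j), CharTwo.sub_eq_add]
      rfl
    rw [hf]
    exact ⟨φ, hφ1, fun _ _ => rfl⟩

/-- The equations of the fixed points of a permutation: coefficients of the values on triples. -/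
def colV (blk : Fin n → Fin n → Fin N) (fst snd : Fin N → Fin n) (σ : Fin n → Fin n)
    (i : Fin N) : ℕ :=
  Nat.ofBits fun j => (blk (σ (fst j)) (σ (snd j)) == i) ^^ (j == i)

/-- The equations of the fixed points of a permutation: coefficients of the coboundary. -/
def colU (m : Fin n → Fin n → Fin n) (fst snd : Fin N → Fin n) (i : Fin n) : ℕ :=
  Nat.ofBits fun j => (fst j == i) ^^ ((snd j == i) ^^ (m (fst j) (snd j) == i))

theorem bit_ofBits (F : Fin N → Bool) (j : Fin N) :
    XorCount.bit (Nat.ofBits F) j = if F j then 1 else 0 := by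
  rw [XorCount.bit, Nat.testBit_ofBits_lt _ _ j.2]

theorem bit_ofBits_ge (F : Fin N → Bool) {j : ℕ} (hj : N ≤ j) :
    XorCount.bit (Nat.ofBits F) j = 0 := by
  rw [XorCount.bit, Nat.testBit_ofBits_ge _ _ hj]
  simp

theorem ite_xor (a b : Bool) : (if (a ^^ b) = true then (1 : ZMod 2) else 0) =
    (if a then 1 else 0) + if b then 1 else 0 := by
  revert a b; decide

theorem sum_colV (σ : Fin n → Fin n) (v : Fin N → ZMod 2) (j : Fin N) :
    ∑ i, v i * XorCount.bit (colV blk fst snd σ i) j = v (blk (σ (fst j)) (σ (snd j))) + v j := by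
  simp only [colV, bit_ofBits, ite_xor, mul_add, Finset.sum_add_distrib]
  simp

theorem sum_colU (u : Fin n → ZMod 2) (j : Fin N) :
    ∑ i, u i * XorCount.bit (colU m fst snd i) j =
      u (fst j) + u (snd j) + u (m (fst j) (snd j)) := by
  simp only [colU, bit_ofBits, ite_xor, mul_add, Finset.sum_add_distrib, add_assoc]
  simp

/-- Relations between the columns `colU` are the kernel of the coboundary map, so the hypothesis
says that this map is injective. -/
theorem eq_zero_of_relDim (hU : XorCount.relDim n (List.ofFn (colU m fst snd)) = 0)
    {u : Fin n → ZMod 2} (hu : ∀ j, u (fst j) + u (snd j) + u (m (fst j) (snd j)) = 0) : u = 0 := by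
  have hc := XorCount.card_solutions_eq (colU m fst snd)
  rw [hU, pow_zero, Nat.card_eq_one_iff_unique] at hc
  have key : ∀ u : Fin n → ZMod 2, (∀ j : Fin N, u (fst j) + u (snd j) + u (m (fst j) (snd j)) = 0) →
      ∀ j : ℕ, ∑ i, u i * XorCount.bit (colU m fst snd i) j = 0 := by
    intro u hu j
    -- The columns have only `N` digits, one per triple, so the equations with higher index are
    -- void.
    rcases lt_or_ge j N with hj | hj
    · exact (sum_colU u ⟨j, hj⟩).trans (hu _)
    · simp [colU, bit_ofBits_ge _ hj]
  have := hc.1.elim ⟨u, key u hu⟩ ⟨0, key 0 (by simp)⟩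
  exact congrArg Subtype.val this

theorem card_coboundaries (hU : XorCount.relDim n (List.ofFn (colU m fst snd)) = 0) :
    Nat.card (h.sys.coboundaries.addSubgroupOf h.sys.factorSystems) = 2 ^ n := by
  have e : Function.Bijective (fun u : Fin n → ZMod 2 =>
      (⟨h.factorEquiv fun j => u (fst j) + u (snd j) + u (m (fst j) (snd j)),
        (h.mem_coboundaries_iff _).2 ⟨u, fun j => by
          rw [h.factorEquiv_apply _ (h.fst_ne j), h.blk_fst]⟩⟩ :
        h.sys.coboundaries.addSubgroupOf h.sys.factorSystems)) := by
    constructor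
    · intro u w e
      have e := h.factorEquiv.injective (congrArg Subtype.val e)
      rw [← sub_eq_zero]
      refine eq_zero_of_relDim hU fun j => ?_
      have := congrFun e j
      simp only [Pi.sub_apply]
      linear_combination this
    · rintro ⟨f, hf⟩
      obtain ⟨u, hu⟩ := (h.mem_coboundaries_iff _).1 hf
      refine ⟨u, Subtype.ext (h.factor_ext fun j => ?_)⟩
      rw [hu, h.factorEquiv_apply _ (h.fst_ne j), h.blk_fst]
  rw [← Nat.card_eq_of_bijective _ e]
  simp

theorem mem_fixedBy_iff (σ : h.sys.aut) (f : h.sys.factorSystems) :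
    (QuotientAddGroup.mk f : h.sys.ExtClasses) ∈
      MulAction.fixedBy h.sys.ExtClasses (h.sys.autEquiv σ) ↔
    ∃ u : Fin n → ZMod 2, ∀ j,
      f.1 (h.sys.pt (σ.1 (fst j))) (h.sys.pt (σ.1 (snd j))) +
        f.1 (h.sys.pt (fst j)) (h.sys.pt (snd j)) =
      u (fst j) + u (snd j) + u (m (fst j) (snd j)) := by
  -- An element and its inverse fix the same classes; the inverse of σ acts by substituting σ
  -- itself.
  rw [← MulAction.fixedBy_inv, MulAction.mem_fixedBy]
  change (QuotientAddGroup.mk ((h.sys.autEquiv σ)⁻¹ • f) : h.sys.ExtClasses) = _ ↔ _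
  rw [QuotientAddGroup.eq, h.mem_coboundaries_iff]
  refine exists_congr fun u => forall_congr' fun j => ?_
  change -(f.1 ((h.sys.autEquiv σ)⁻¹⁻¹ (h.sys.pt (fst j))) ((h.sys.autEquiv σ)⁻¹⁻¹ (h.sys.pt (snd j)))) +
    f.1 (h.sys.pt (fst j)) (h.sys.pt (snd j)) = _ ↔ _
  rw [inv_inv, CharTwo.neg_eq, autEquiv_pt, autEquiv_pt]

/-- Both sides count the factor systems with fixed class: on the left by cosets of the coboundaries,
on the right as the solutions (v, u) of v∘σ + v + δu = 0, where u is determined by v because δ is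
injective. -/
theorem card_fixedBy (hU : XorCount.relDim n (List.ofFn (colU m fst snd)) = 0) (σ : h.sys.aut) :
    2 ^ n * Nat.card (MulAction.fixedBy h.sys.ExtClasses (h.sys.autEquiv σ)) =
      2 ^ XorCount.relDim (N + n)
        (List.ofFn (colV blk fst snd σ.1) ++ List.ofFn (colU m fst snd)) := by
  rw [← List.ofFn_fin_append, ← XorCount.card_solutions_eq, ← h.card_coboundaries hU,
    ← Nat.card_prod, ← Nat.card_congr (QuotientAddGroup.preimageMkEquivAddSubgroupProdSet _ _)]
  have hsum : ∀ (x : Fin (N + n) → ZMod 2) (j : Fin N),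
      ∑ i, x i * XorCount.bit (Fin.append (colV blk fst snd σ.1) (colU m fst snd) i) j =
        x (Fin.castAdd n (blk (σ.1 (fst j)) (σ.1 (snd j)))) + x (Fin.castAdd n j) +
        (x (Fin.natAdd N (fst j)) + x (Fin.natAdd N (snd j)) +
          x (Fin.natAdd N (m (fst j) (snd j)))) := by
    intro x j
    rw [Fin.sum_univ_add]
    simp only [Fin.append_left, Fin.append_right]
    exact congrArg₂ (· + ·) (sum_colV σ.1 (fun i => x (Fin.castAdd n i)) j)
      (sum_colU (fun i => x (Fin.natAdd N i)) j)
  have hsum' : ∀ (x : Fin (N + n) → ZMod 2) (j : ℕ), N ≤ j →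
      ∑ i, x i * XorCount.bit (Fin.append (colV blk fst snd σ.1) (colU m fst snd) i) j = 0 := by
    intro x j hj
    rw [Fin.sum_univ_add]
    simp [colV, colU, bit_ofBits_ge _ hj]
  have hσ : ∀ j, σ.1 (fst j) ≠ σ.1 (snd j) := fun j e => h.fst_ne j (σ.1.injective e)
  symm
  refine Nat.card_eq_of_bijective (fun x => ⟨h.factorEquiv fun i => x.1 (Fin.castAdd n i), ?_⟩) ⟨?_, ?_⟩
  · refine (h.mem_fixedBy_iff σ _).2 ⟨fun i => x.1 (Fin.natAdd N i), fun j => ?_⟩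
    rw [h.factorEquiv_apply _ (h.fst_ne j), h.factorEquiv_apply _ (hσ j), h.blk_fst]
    have := x.2 j
    rw [hsum] at this
    rwa [← CharTwo.sub_eq_add, sub_eq_zero] at this
  · intro x y e
    have e1 := h.factorEquiv.injective (congrArg Subtype.val e)
    have e2 : (fun i => x.1 (Fin.natAdd N i) - y.1 (Fin.natAdd N i)) = 0 := by
      refine eq_zero_of_relDim hU fun j => ?_
      have hx := x.2 j
      have hy := y.2 j
      rw [hsum] at hx hy
      have e3 := congrFun e1 (blk (σ.1 (fst j)) (σ.1 (snd j)))
      have e4 := congrFun e1 j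
      linear_combination hx - hy - e3 - e4
    apply Subtype.ext
    funext i
    refine Fin.addCases (fun i => congrFun e1 i) (fun i => sub_eq_zero.1 (congrFun e2 i)) i
  · rintro ⟨f, hf⟩
    obtain ⟨u, hu⟩ := (h.mem_fixedBy_iff σ f).1 hf
    obtain ⟨v, rfl⟩ := h.factorEquiv.surjective f
    refine ⟨⟨Fin.append v u, fun j => ?_⟩, Subtype.ext ?_⟩
    · rcases lt_or_ge j N with hj | hj
      · refine (hsum _ ⟨j, hj⟩).trans ?_
        simp only [Fin.append_left, Fin.append_right]
        rw [← hu, h.factorEquiv_apply _ (h.fst_ne _), h.factorEquiv_apply _ (hσ _), h.blk_fst,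
          CharTwo.add_self_eq_zero]
      · exact hsum' _ j hj
    · simp only [Fin.append_left]

/-- The number of extension classes and the number of their orbits, from the dimensions of the
spaces of fixed points. -/
theorem card_orbits (hU : XorCount.relDim n (List.ofFn (colU m fst snd)) = 0)
    {ι : Type*} [Fintype ι] (e : ι ≃ h.sys.aut) :
    2 ^ n * (Nat.card h.sys.ExtOrbits * Fintype.card ι) =
      ∑ i, 2 ^ XorCount.relDim (N + n)
        (List.ofFn (colV blk fst snd (e i).1) ++ List.ofFn (colU m fst snd)) := by
  classical
  have hf : Finite h.sys.factorSystems := Finite.of_equiv _ h.factorEquiv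
  have : Fintype h.sys.ExtClasses := Fintype.ofFinite _
  have : Fintype (MulAut h.sys.Loop) := Fintype.ofEquiv ι (e.trans h.sys.autEquiv.toEquiv)
  have : Fintype h.sys.ExtOrbits := Fintype.ofFinite _
  -- Burnside's lemma.
  have hb := MulAction.sum_card_fixedBy_eq_card_orbits_mul_card_group (MulAut h.sys.Loop)
    h.sys.ExtClasses
  have hcard : Fintype.card (MulAut h.sys.Loop) = Fintype.card ι :=
    Fintype.card_congr (e.trans h.sys.autEquiv.toEquiv).symm
  rw [hcard] at hb
  rw [Nat.card_eq_fintype_card, ← hb, Finset.mul_sum]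
  refine (Fintype.sum_equiv (e.trans h.sys.autEquiv.toEquiv) _ _ fun i => ?_).symm
  rw [← h.card_fixedBy hU, Nat.card_eq_fintype_card]
  rfl

theorem card_extClasses (hU : XorCount.relDim n (List.ofFn (colU m fst snd)) = 0) :
    2 ^ n * Nat.card h.sys.ExtClasses = 2 ^ N := by
  rw [← h.card_coboundaries hU, mul_comm]
  refine (AddSubgroup.card_eq_card_quotient_mul_card_addSubgroup _).symm.trans ?_
  rw [← Nat.card_congr h.factorEquiv]
  simp

end Numbering

end STS

/-! ### Exhaustive search for systems of order 13 -/

/-- A totally symmetric idempotent product, that is, a Steiner triple system given by the third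
point of each triple. -/
structure IsSteinerProd {α : Type*} (m : α → α → α) : Prop where
  self : ∀ x, m x x = x
  comm : ∀ x y, m x y = m y x
  mul_mul : ∀ x y, m x (m x y) = y

namespace IsSteinerProd

variable {α : Type*} {m : α → α → α} (h : IsSteinerProd m)

include h

theorem cancel {x y z : α} (e : m x y = m x z) : y = z := by
  rw [← h.mul_mul x y, e, h.mul_mul]

theorem ne_left {x y : α} (hxy : x ≠ y) : m x y ≠ x := fun e =>
  hxy (h.cancel ((h.self x).trans e.symm))

theorem ne_right {x y : α} (hxy : x ≠ y) : m x y ≠ y := by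
  rw [h.comm]
  exact h.ne_left hxy.symm

end IsSteinerProd

/-! Partial multiplication tables, coded as natural numbers: the hexadecimal digit of the entry at
`(i, j)` is `0` if the product is unknown, and `l + 1` if it is the point with number `l`. The
arithmetic is written with the functions that the kernel evaluates directly. -/

namespace PartialTable

/-- The code of the product of `i` and `j`. -/
def get (T i j : ℕ) : ℕ :=
  Nat.mod (Nat.shiftRight T (Nat.add (Nat.mul 64 i) (Nat.mul 4 j))) 16

/-- Enter `l` as the product of `i` and `j`, if this is unknown. -/
def set (T i j l : ℕ) : ℕ :=
  bif Nat.beq (get T i j) 0 then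
    Nat.xor T (Nat.shiftLeft (Nat.succ l) (Nat.add (Nat.mul 64 i) (Nat.mul 4 j)))
  else T

/-- Enter a triple. -/
def add (T i j l : ℕ) : ℕ :=
  set (set (set (set (set (set T i j l) j i l) i l j) l i j) j l i) l j i

/-- The pairs of numbers below `k`, in lexicographic order. -/
def pairs (k : ℕ) : List (ℕ × ℕ) :=
  (List.range k).flatMap fun i => ((List.range k).filter (Nat.blt i)).map fun j => (i, j)

/-- The entry `a` is known and different from `b`. -/
def clash (a b : ℕ) : Bool := !(Nat.beq a 0) && !(Nat.beq a (Nat.succ b))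

/-- The triple `{i, j, l}` is not compatible with the table. -/
def conflict (T i j l : ℕ) : Bool :=
  Nat.beq l i || Nat.beq l j || clash (get T i l) j || clash (get T j l) i

/-- Search through all systems on 13 points that extend a partial table of `k` points. The list `ps`
holds the pairs whose product is still to be determined; a branch ends as soon as the last triple
satisfies `acc`, or when the table is complete and satisfies `leaf`. -/
def search (acc : ℕ → ℕ → ℕ → ℕ → Bool) (leaf : ℕ → ℕ → Bool) :
    ℕ → ℕ → ℕ → List (ℕ × ℕ) → Bool
  | 0, _, _, _ => false
  | f + 1, T, k, ps =>
    match ps.dropWhile fun p => !(Nat.beq (get T p.1 p.2) 0) with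
    | [] => leaf T k || (Nat.blt k 13 && search acc leaf f T (Nat.succ k) (pairs (Nat.succ k)))
    | (i, j) :: ps =>
      ((List.range k).all fun l => conflict T i j l || acc (add T i j l) k i j ||
        search acc leaf f (add T i j l) k ps) &&
      (Nat.ble 13 k || acc (add T i j k) (Nat.succ k) i j ||
        search acc leaf f (add T i j k) (Nat.succ k) (pairs (Nat.succ k)))

/-- The triple `{a, b, l}` lies in a Pasch configuration with a point outside on triples with `a`
and `b`. -/
def paschAt (T k a b l : ℕ) : Bool :=
  !(Nat.beq a b) && Nat.beq (get T a b) (Nat.succ l) && (List.range k).any fun x =>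
    !(Nat.beq x a) && !(Nat.beq x b) && !(Nat.beq x l) &&
    !(Nat.beq (get T a x) 0) && !(Nat.beq (get T b x) 0) &&
    Nat.beq (get T (Nat.pred (get T a x)) (Nat.pred (get T b x))) (Nat.succ l)

/-- The triple through `i` and `j` lies in a Pasch configuration. -/
def hasPasch (T k i j : ℕ) : Bool :=
  (fun l => paschAt T k i j l || paschAt T k i l j || paschAt T k j l i) (Nat.pred (get T i j))

/-- The complete table `T` is isomorphic to one of the given tables, by a bijection that has given
values at `0`, `1` and `3`. -/
def leafIso (cands : List (ℕ × ℕ × ℕ × ℕ)) (T k : ℕ) : Bool :=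
  Nat.beq k 13 &&
    (fun words : List (ℕ × ℕ × ℕ) => cands.any fun c =>
      (fun s => (pairs 13).all fun p => !(Nat.beq (get T p.1 p.2) 0) &&
        Nat.beq (get c.1 (get s 0 p.1) (get s 0 p.2))
          (Nat.succ (get s 0 (Nat.pred (get T p.1 p.2)))) &&
        !(Nat.beq (get s 0 p.1) (get s 0 p.2)))
      -- The digits of `s` are the images of the points, without the shift by one used in tables.
      (words.foldl (fun s w => Nat.xor s (Nat.shiftLeft
          (Nat.pred (get c.1 (get s 0 w.2.1) (get s 0 w.2.2))) (Nat.mul 4 w.1)))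
        (Nat.xor c.2.1 (Nat.xor (Nat.shiftLeft c.2.2.1 4) (Nat.shiftLeft c.2.2.2 12)))))
    -- Each remaining point is sought as a product of two points of smaller number, so its image is
    -- forced. The default pair is harmless because the resulting map is tested on all products.
    ([2, 4, 5, 6, 7, 8, 9, 10, 11, 12].map fun n =>
      (n, ((pairs n).find? fun p => Nat.beq (get T p.1 p.2) (Nat.succ n)).getD (0, 0)))

/-- The ways to place a Pasch configuration in the table `U`, with first point in `as`. -/
def cands (U : ℕ) (as : List ℕ) : List (ℕ × ℕ × ℕ × ℕ) :=
  as.flatMap fun a => (List.range 13).flatMap fun b => ((List.range 13).filter fun c =>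
    !(Nat.beq a b) && !(Nat.beq a c) && !(Nat.beq b c) &&
    !(Nat.beq (get U a b) (Nat.succ c)) &&
    Nat.beq (get U (Nat.pred (get U a b)) (Nat.pred (get U a c))) (get U b c)).map
      fun c => (U, a, b, c)

theorem beq_eq_false {a b : ℕ} : Nat.beq a b = false ↔ a ≠ b := by
  rw [← Bool.not_eq_true, Nat.beq_eq]

theorem get_lt (T i j : ℕ) : get T i j < 16 := Nat.mod_lt _ (by norm_num)

theorem get_eq (T i j : ℕ) : get T i j = (T >>> (64 * i + 4 * j)) % 2 ^ 4 := rfl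

/-- The entries occupy disjoint blocks of four bits, so a change of one block is invisible in blocks
above and below it. -/
theorem get_set {T i j l a b c : ℕ} (hj : j < 16) (hl : l < 15) (hb : b < 16)
    (h : get (set T i j l) a b = c + 1) :
    get T a b = c + 1 ∨ a = i ∧ b = j ∧ c = l := by
  rw [set, cond_eq_ite] at h
  split_ifs at h with h0
  · have h0 := Nat.eq_of_beq_eq_true h0
    have hx : get (Nat.xor T (Nat.shiftLeft (Nat.succ l) (Nat.add (Nat.mul 64 i) (Nat.mul 4 j)))) a b
        = get T a b ^^^ ((l + 1) <<< (64 * i + 4 * j)) >>> (64 * a + 4 * b) % 2 ^ 4 := by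
      change ((T ^^^ ((l + 1) <<< (64 * i + 4 * j))) >>> (64 * a + 4 * b)) % 2 ^ 4 = _
      rw [Nat.shiftRight_xor_distrib, Nat.xor_mod_two_pow]
      rfl
    rw [hx] at h
    rcases lt_trichotomy (64 * i + 4 * j) (64 * a + 4 * b) with e | e | e
    · left
      have : ((l + 1) <<< (64 * i + 4 * j)) >>> (64 * a + 4 * b) = 0 := by
        obtain ⟨d, hd⟩ := Nat.exists_eq_add_of_lt e
        -- Both positions are multiples of four.
        have h4 : 4 ≤ d + 1 := by omega
        rw [hd, add_assoc, Nat.shiftRight_add, Nat.shiftLeft_shiftRight, Nat.shiftRight_eq_div_pow]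
        refine Nat.div_eq_of_lt (lt_of_lt_of_le ?_ (Nat.pow_le_pow_right (by norm_num) h4))
        omega
      rwa [this, Nat.zero_mod, Nat.xor_zero] at h
    · right
      have h1 : a = i := by omega
      have h2 : b = j := by omega
      refine ⟨h1, h2, ?_⟩
      rw [← e, Nat.shiftLeft_shiftRight, h1, h2, h0, Nat.zero_xor] at h
      omega
    · left
      have : ((l + 1) <<< (64 * i + 4 * j)) >>> (64 * a + 4 * b) % 2 ^ 4 = 0 := by
        obtain ⟨d, hd⟩ := Nat.exists_eq_add_of_lt e
        have h4 : d + 1 = 4 + (d - 3) := by omega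
        rw [hd, add_assoc, Nat.add_comm _ (d + 1), Nat.shiftLeft_add, Nat.shiftLeft_shiftRight, h4,
          Nat.add_comm 4,
          Nat.shiftLeft_add, Nat.shiftLeft_eq _ 4, Nat.mul_mod_left]
      rwa [this, Nat.xor_zero] at h
  · exact Or.inl h

theorem mem_pairs {k : ℕ} {p : ℕ × ℕ} : p ∈ pairs k ↔ p.1 < p.2 ∧ p.2 < k := by
  obtain ⟨i, j⟩ := p
  simp only [pairs, List.mem_flatMap, List.mem_range, List.mem_map, List.mem_filter,
    Nat.blt_eq, Prod.mk.injEq]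
  constructor
  · rintro ⟨a, -, b, ⟨h1, h2⟩, rfl, rfl⟩
    exact ⟨h2, h1⟩
  · rintro ⟨h1, h2⟩
    exact ⟨i, by omega, j, ⟨h2, h1⟩, rfl, rfl⟩

/-- The points `p 0, …, p (k - 1)` are different, and the known entries of `T` are their
products. -/
structure Model (m : Fin 13 → Fin 13 → Fin 13) (p : ℕ → Fin 13) (k T : ℕ) : Prop where
  inj : ∀ i j, i < k → j < k → p i = p j → i = j
  known : ∀ i j l, i < 16 → j < 16 → get T i j = l + 1 →
    i < k ∧ j < k ∧ l < k ∧ m (p i) (p j) = p l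

namespace Model

variable {m : Fin 13 → Fin 13 → Fin 13} {p : ℕ → Fin 13} {k T : ℕ}

theorem le (h : Model m p k T) : k ≤ 13 := by
  have := Fintype.card_le_of_injective (fun i : Fin k => p i) fun i j e =>
    Fin.ext (h.inj i j i.2 j.2 e)
  simpa using this

theorem set (h : Model m p k T) {a b c : ℕ} (ha : a < k) (hb : b < k) (hc : c < k)
    (e : m (p a) (p b) = p c) : Model m p k (set T a b c) := by
  have hk := h.le
  refine ⟨h.inj, fun i j l hi hj hl => ?_⟩
  rcases get_set (by omega) (by omega) hj hl with h1 | ⟨rfl, rfl, rfl⟩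
  · exact h.known i j l hi hj h1
  · exact ⟨ha, hb, hc, e⟩

theorem add (hm : IsSteinerProd m) (h : Model m p k T) {a b c : ℕ} (ha : a < k) (hb : b < k)
    (hc : c < k) (e : m (p a) (p b) = p c) : Model m p k (add T a b c) := by
  have e2 : m (p a) (p c) = p b := by rw [← e, hm.mul_mul]
  have e3 : m (p b) (p c) = p a := by rw [← e, hm.comm (p a), hm.mul_mul]
  have e' : m (p b) (p a) = p c := by rw [hm.comm, e]
  have e2' : m (p c) (p a) = p b := by rw [hm.comm, e2]
  have e3' : m (p c) (p b) = p a := by rw [hm.comm, e3]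
  exact (((((h.set ha hb hc e).set hb ha hc e').set ha hc hb e2).set hc ha hb e2').set hb hc ha
    e3).set hc hb ha e3'

theorem fresh (h : Model m p k T) {z : Fin 13} (hz : ∀ i < k, p i ≠ z) :
    Model m (Function.update p k z) (k + 1) T := by
  have hp : ∀ i < k, Function.update p k z i = p i := fun i hi =>
    Function.update_of_ne (by omega) _ _
  refine ⟨fun i j hi hj e => ?_, fun i j l hi hj e => ?_⟩
  · rcases Nat.lt_succ_iff_lt_or_eq.1 hi with hi | rfl <;>
      rcases Nat.lt_succ_iff_lt_or_eq.1 hj with hj | rfl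
    · rw [hp i hi, hp j hj] at e
      exact h.inj i j hi hj e
    · rw [hp i hi, Function.update_self] at e
      exact absurd e (hz i hi)
    · rw [hp j hj, Function.update_self] at e
      exact absurd e.symm (hz j hj)
    · rfl
  · obtain ⟨h1, h2, h3, h4⟩ := h.known i j l hi hj e
    rw [hp i h1, hp j h2, hp l h3]
    exact ⟨by omega, by omega, by omega, h4⟩

end Model

theorem exists_fresh (p : ℕ → Fin 13) {k : ℕ} (hk : k < 13) : ∃ z, ∀ i < k, p i ≠ z := by
  by_contra! H
  have hs : Function.Surjective (fun i : Fin k => p i) := fun z => by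
    obtain ⟨i, hi, e⟩ := H z
    exact ⟨⟨i, hi⟩, e⟩
  have := Fintype.card_le_of_surjective _ hs
  simp only [Fintype.card_fin] at this
  omega

theorem not_conflict {m : Fin 13 → Fin 13 → Fin 13} (hm : IsSteinerProd m) {p : ℕ → Fin 13}
    {k T i j l : ℕ} (h : Model m p k T) (hij : i < j) (hj : j < k) (hl : l < k)
    (e : m (p i) (p j) = p l) : conflict T i j l = false := by
  have hk := h.le
  have hne : p i ≠ p j := fun e => by
    have := h.inj i j (by omega) hj e
    omega
  have clash_eq : ∀ a b c d, a < k → b < k → d < k → m (p a) (p b) = p d → c = get T a b →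
      clash c d = false := by
    intro a b c d ha hb hd e hc
    rcases c with _ | c
    · rfl
    · obtain ⟨-, -, h1, h2⟩ := h.known a b c (by omega) (by omega) hc.symm
      have := h.inj c d h1 hd (h2.symm.trans e)
      simp [clash, this]
  have h1 : Nat.beq l i = false := by
    rw [beq_eq_false]
    rintro rfl
    exact hm.ne_left hne e
  have h2 : Nat.beq l j = false := by
    rw [beq_eq_false]
    rintro rfl
    exact hm.ne_right hne e
  rw [conflict, h1, h2, clash_eq i l _ j (by omega) hl hj (by rw [← e, hm.mul_mul]) rfl,
    clash_eq j l _ i hj hl (by omega) (by rw [← e, hm.comm (p i), hm.mul_mul]) rfl]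
  rfl

/-- An actual system with labelled points selects a branch at every node: an unknown product is a
labelled point, or it receives the next label. The selected path must end in a success of `acc` or
`leaf`, since running out of fuel counts as failure. -/
theorem search_sound {m : Fin 13 → Fin 13 → Fin 13} (hm : IsSteinerProd m)
    {acc : ℕ → ℕ → ℕ → ℕ → Bool} {leaf : ℕ → ℕ → Bool} {G : Prop}
    (hacc : ∀ T k i j p, Model m p k T → i < k → j < k → acc T k i j = true → G)
    (hleaf : ∀ T k p, Model m p k T → leaf T k = true → G) (f : ℕ) :
    ∀ T k ps p, Model m p k T → (∀ q ∈ ps, q.1 < q.2 ∧ q.2 < k) →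
      search acc leaf f T k ps = true → G := by
  induction f with
  | zero => intro T k ps p _ _ h; cases h
  | succ f ih =>
    intro T k ps p hM hps h
    rw [search] at h
    have hsub : ∀ q ∈ ps.dropWhile (fun p => !(Nat.beq (get T p.1 p.2) 0)),
        q.1 < q.2 ∧ q.2 < k := fun q hq => hps q ((List.dropWhile_suffix _).subset hq)
    revert h hsub
    generalize ps.dropWhile (fun p => !(Nat.beq (get T p.1 p.2) 0)) = qs
    intro h hsub
    rcases qs with _ | ⟨⟨i, j⟩, qs⟩
    · simp only [Bool.or_eq_true, Bool.and_eq_true, Nat.blt_eq] at h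
      rcases h with h | ⟨hk, h⟩
      · exact hleaf T k p hM h
      · obtain ⟨z, hz⟩ := exists_fresh p hk
        exact ih _ _ _ _ (hM.fresh hz) (fun q hq => mem_pairs.1 hq) h
    · obtain ⟨hij, hj⟩ : i < j ∧ j < k := hsub _ List.mem_cons_self
      simp only [Bool.and_eq_true, List.all_eq_true, List.mem_range, Bool.or_eq_true] at h
      obtain ⟨h1, h2⟩ := h
      by_cases hz : ∀ l < k, p l ≠ m (p i) (p j)
      · have hM' := hM.fresh hz
        have hp : ∀ a < k, Function.update p k (m (p i) (p j)) a = p a := fun a ha =>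
          Function.update_of_ne (by omega) _ _
        have hM2 := hM'.add hm (a := i) (b := j) (c := k) (by omega) (by omega) (by omega)
          (by rw [hp i (by omega), hp j hj, Function.update_self])
        rcases h2 with (h2 | h2) | h2
        -- With 13 labels in use there is no room for a new point.
        · have := hM'.le
          have := Nat.le_of_ble_eq_true h2
          omega
        · exact hacc _ _ _ _ _ hM2 (by omega) (by omega) h2
        · exact ih _ _ _ _ hM2 (fun q hq => mem_pairs.1 hq) h2
      · push Not at hz
        obtain ⟨l, hl, e⟩ := hz
        have hM2 := hM.add hm (by omega) hj hl e.symm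
        have := h1 l hl
        rw [not_conflict hm hM hij hj hl e.symm] at this
        rcases this with (h3 | h3) | h3
        · cases h3
        · exact hacc _ _ _ _ _ hM2 (by omega) hj h3
        · exact ih _ _ _ _ hM2 (fun q hq => hsub q (List.mem_cons_of_mem _ hq)) h3

theorem model_zero (m : Fin 13 → Fin 13 → Fin 13) {p : ℕ → Fin 13} {k : ℕ}
    (h : ∀ i j, i < k → j < k → p i = p j → i = j) : Model m p k 0 := by
  refine ⟨h, fun i j l _ _ e => ?_⟩
  rw [get_eq, Nat.zero_shiftRight] at e
  cases e

/-- The system contains a Pasch configuration. -/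
def HasPasch (m : Fin 13 → Fin 13 → Fin 13) : Prop :=
  ∃ x a b, x ≠ a ∧ x ≠ b ∧ a ≠ b ∧ m x a ≠ b ∧ m (m x a) (m x b) = m a b

theorem hasPasch_of_paschAt {m : Fin 13 → Fin 13 → Fin 13} (hm : IsSteinerProd m) {T k a b l : ℕ}
    {p : ℕ → Fin 13} (h : Model m p k T) (h1 : a < 16) (h2 : b < 16)
    (e : paschAt T k a b l = true) : HasPasch m := by
  have hk := h.le
  simp only [paschAt, Bool.and_eq_true, Bool.not_eq_true', beq_eq_false, Nat.beq_eq,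
    List.any_eq_true, List.mem_range] at e
  obtain ⟨⟨hab, hl⟩, x, hx, ⟨⟨⟨⟨hxa, hxb⟩, hxl⟩, hy⟩, hw⟩, hd⟩ := e
  obtain ⟨ha, hb, hl', e1⟩ := h.known a b l h1 h2 hl
  obtain ⟨y, hy⟩ := Nat.exists_eq_succ_of_ne_zero hy
  obtain ⟨w, hw⟩ := Nat.exists_eq_succ_of_ne_zero hw
  obtain ⟨-, -, hyk, e2⟩ := h.known a x y h1 (by omega) hy
  obtain ⟨-, -, hwk, e3⟩ := h.known b x w h2 (by omega) hw
  rw [hy, hw] at hd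
  obtain ⟨-, -, -, e4⟩ := h.known y w l (by omega) (by omega) hd
  have hne : ∀ {i j}, i < k → j < k → i ≠ j → p i ≠ p j := fun hi hj hij e =>
    hij (h.inj _ _ hi hj e)
  refine ⟨p x, p a, p b, hne hx ha hxa, hne hx hb hxb, hne ha hb hab, fun e => ?_, ?_⟩
  · refine hne hx hl' hxl ?_
    rw [← e1, ← e, hm.comm (p x), hm.mul_mul]
  · rw [hm.comm (p x), hm.comm (p x), e2, e3, e4, e1]

theorem hasPasch_sound {m : Fin 13 → Fin 13 → Fin 13} (hm : IsSteinerProd m) (T k i j : ℕ)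
    (p : ℕ → Fin 13) (h : Model m p k T) (hi : i < k) (hj : j < k)
    (e : hasPasch T k i j = true) : HasPasch m := by
  have hk := h.le
  have hl := get_lt T i j
  have hl' := Nat.pred_le (get T i j)
  simp only [hasPasch, Bool.or_eq_true] at e
  rcases e with (e | e) | e <;> exact hasPasch_of_paschAt hm h (by omega) (by omega) e

/-- No complete table is accepted, so every branch has to close with a Pasch configuration. The fuel
40 leaves room for 26 triples and 13 new points. -/
theorem search_hasPasch : search hasPasch (fun _ _ => false) 40 0 0 [] = true := by
  decide +kernel

theorem exists_pasch {m : Fin 13 → Fin 13 → Fin 13} (hm : IsSteinerProd m) : HasPasch m :=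
  search_sound hm (hasPasch_sound hm) (fun _ _ _ _ h => by cases h) 40 0 0 []
    (fun _ => 0) (model_zero m (by omega)) (by simp) search_hasPasch

/-- The table of a Pasch configuration. -/
def paschTable : ℕ := add (add (add (add 0 0 1 2) 0 3 4) 1 3 5) 2 4 5

theorem exists_model_pasch {m : Fin 13 → Fin 13 → Fin 13} (hm : IsSteinerProd m) :
    ∃ p, Model m p 6 paschTable := by
  obtain ⟨x, a, b, hxa, hxb, hab, hyb, e⟩ := exists_pasch hm
  -- The order of the six points is that of the labels in `paschTable`.
  let p : ℕ → Fin 13 := fun i => ([x, a, m x a, b, m x b, m a b].getD i x)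
  have n1 := hm.ne_left hxa
  have n2 := hm.ne_right hxa
  have n3 := hm.ne_left hxb
  have n4 := hm.ne_right hxb
  have n5 := hm.ne_left hab
  have n6 := hm.ne_right hab
  have n7 : m x b ≠ a := fun h => hyb (by rw [← h, hm.mul_mul])
  have n8 : m a b ≠ x := fun h => hyb (by rw [← h, hm.comm, hm.mul_mul])
  have n9 : m x a ≠ m x b := fun h => hab (hm.cancel h)
  have n10 : m x a ≠ m a b := fun h => hxb (by rw [hm.comm] at h; exact hm.cancel h)
  have n11 : m x b ≠ m a b := fun h => hxa (by
    rw [hm.comm x, hm.comm a] at h; exact hm.cancel h)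
  have hp : ∀ i j, i < 6 → j < 6 → p i = p j → i = j := by
    intro i j hi hj h
    interval_cases i <;> interval_cases j <;>
      first
      | rfl
      | exact absurd h (by assumption)
      | exact absurd h.symm (by assumption)
  exact ⟨p, ((((model_zero m hp).add hm (by norm_num) (by norm_num) (by norm_num) rfl).add hm
    (by norm_num) (by norm_num) (by norm_num) rfl).add hm (by norm_num) (by norm_num)
    (by norm_num) rfl).add hm (by norm_num) (by norm_num) (by norm_num) e⟩

/-- The product coded by a complete table. -/
def prod (U : ℕ) (x y : Fin 13) : Fin 13 := Fin.ofNat 13 (Nat.pred (get U x y))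

/-- Only entries for the numbers below 13 are known, with values below 13. -/
def Bounded (U : ℕ) : Prop :=
  ∀ a < 16, ∀ b < 16, get U a b ≠ 0 → a < 13 ∧ b < 13 ∧ get U a b ≤ 13

theorem leafIso_sound {m : Fin 13 → Fin 13 → Fin 13} (hm : IsSteinerProd m)
    {cs : List (ℕ × ℕ × ℕ × ℕ)} (hb : ∀ c ∈ cs, Bounded c.1 ∧ IsSteinerProd (prod c.1)) (T k : ℕ)
    (p : ℕ → Fin 13) (h : Model m p k T) (e : leafIso cs T k = true) :
    ∃ c ∈ cs, ∃ φ : Fin 13 ≃ Fin 13, ∀ x y, φ (m x y) = prod c.1 (φ x) (φ y) := by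
  simp only [leafIso, Bool.and_eq_true, Nat.beq_eq, List.any_eq_true] at e
  obtain ⟨rfl, c, hc, e⟩ := e
  obtain ⟨hb, hU⟩ := hb c hc
  revert e
  generalize List.foldl _ _ _ = s
  intro e
  simp only [List.all_eq_true, Bool.and_eq_true, Bool.not_eq_true', beq_eq_false,
    Nat.beq_eq, mem_pairs, Prod.forall] at e
  -- Every index lies in a tested pair, whose images have a known product in the target table;
  -- `Bounded` then excludes the digits 13, 14 and 15.
  have hlt : ∀ i < 13, get s 0 i < 13 := by
    intro i hi
    by_cases h0 : i = 0
    · have h1 := (e 0 1 (by norm_num)).1.2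
      rw [h0]
      exact (hb _ (get_lt _ _ _) _ (get_lt _ _ _) (by rw [h1]; exact Nat.succ_ne_zero _)).1
    · have h1 := (e 0 i ⟨by omega, hi⟩).1.2
      exact (hb _ (get_lt _ _ _) _ (get_lt _ _ _) (by rw [h1]; exact Nat.succ_ne_zero _)).2.1
  let σ : Fin 13 → Fin 13 := fun i => ⟨get s 0 i, hlt i i.2⟩
  have hσ : Function.Injective σ := by
    intro i j hij
    have hij : get s 0 i = get s 0 j := congrArg Fin.val hij
    rcases lt_trichotomy i j with h1 | h1 | h1
    · exact absurd hij (e i j ⟨h1, j.2⟩).2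
    · exact h1
    · exact absurd hij.symm (e j i ⟨h1, i.2⟩).2
  have hp : Function.Injective (fun i : Fin 13 => p i) := fun i j hij =>
    Fin.ext (h.inj i j i.2 j.2 hij)
  let P := Equiv.ofBijective _ (Finite.injective_iff_bijective.1 hp)
  let S := Equiv.ofBijective _ (Finite.injective_iff_bijective.1 hσ)
  have key : ∀ i j : Fin 13, i < j → (P.symm.trans S) (m (P i) (P j)) = prod c.1 (S i) (S j) := by
    intro i j hij
    obtain ⟨⟨h1, h2⟩, -⟩ := e i j ⟨hij, j.2⟩
    obtain ⟨l, hl⟩ := Nat.exists_eq_succ_of_ne_zero h1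
    obtain ⟨-, -, hl', h3⟩ := h.known i j l (by omega) (by omega) hl
    have h3 : m (P i) (P j) = P ⟨l, hl'⟩ := h3
    rw [h3, Equiv.trans_apply, Equiv.symm_apply_apply]
    rw [hl] at h2
    apply Fin.ext
    change get s 0 l = Nat.pred (get c.1 (get s 0 i) (get s 0 j)) % 13
    rw [h2]
    exact (Nat.mod_eq_of_lt (hlt l hl')).symm
  refine ⟨c, hc, P.symm.trans S, fun x y => ?_⟩
  obtain ⟨i, rfl⟩ := P.surjective x
  obtain ⟨j, rfl⟩ := P.surjective y
  simp only [Equiv.trans_apply, Equiv.symm_apply_apply] at key ⊢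
  rcases lt_trichotomy i j with h1 | rfl | h1
  · exact key i j h1
  · rw [hm.self, Equiv.symm_apply_apply, hU.self]
  · rw [hm.comm, key j i h1, hU.comm]

end PartialTable

/-! ### Systems given by a product, and automorphisms from generators -/

namespace STS

variable {α β : Type*}

/-- The product `m` describes the third points of the triples of `S`. -/
def HasProd (S : STS α) (m : α → α → α) : Prop :=
  ∀ x y, x ≠ y → S.pt x * S.pt y = S.pt (m x y)

theorem HasProd.image_mem {S : STS α} {T : STS β} {m : α → α → α} {k : β → β → β}
    (hS : S.HasProd m) (hT : T.HasProd k) {φ : α → β} (hi : Function.Injective φ)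
    (h : ∀ x y, φ (m x y) = k (φ x) (φ y)) {t : Set α} (ht : t ∈ S.triples) :
    φ '' t ∈ T.triples := by
  obtain ⟨x, y, z, rfl⟩ := S.exists_of_mem_triples ht
  obtain ⟨hne, hz⟩ := (mem_triples_iff S).1 ht
  rw [hS x y hne] at hz
  rw [Set.image_insert_eq, Set.image_insert_eq, Set.image_singleton, mem_triples_iff,
    hT _ _ (hi.ne hne), ← S.pt_injective hz, h]
  exact ⟨hi.ne hne, rfl⟩

theorem HasProd.triples_iff {S : STS α} {T : STS β} {m : α → α → α} {k : β → β → β}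
    (hS : S.HasProd m) (hT : T.HasProd k) (φ : α ≃ β) (h : ∀ x y, φ (m x y) = k (φ x) (φ y))
    (t : Set α) : t ∈ S.triples ↔ φ '' t ∈ T.triples := by
  refine ⟨hS.image_mem hT φ.injective h, fun ht => ?_⟩
  have := hT.image_mem hS φ.symm.injective (fun x y => by
    rw [Equiv.symm_apply_eq, h, Equiv.apply_symm_apply, Equiv.apply_symm_apply]) ht
  rwa [Equiv.symm_image_image] at this

theorem HasProd.mem_aut {S : STS α} {m : α → α → α} (hS : S.HasProd m) (hm : IsSteinerProd m)
    {σ : Equiv.Perm α} : σ ∈ S.aut ↔ ∀ x y, σ (m x y) = m (σ x) (σ y) := by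
  refine ⟨fun h x y => ?_, fun h => hS.triples_iff hS σ h⟩
  by_cases hne : x = y
  · rw [hne, hm.self, hm.self]
  · apply S.pt_injective
    rw [← hS _ _ (σ.injective.ne hne), ← S.autEquiv_pt ⟨σ, h⟩, ← hS _ _ hne, map_mul]
    rfl

theorem exists_hasProd (S : STS α) : ∃ m, IsSteinerProd m ∧ S.HasProd m := by
  classical
  have hL := S.isSteinerLoop_loop
  refine ⟨fun x y => if h : x = y then x else S.third h, ?_, fun x y h => ?_⟩
  · have key : ∀ {x y}, x ≠ y →
        S.pt x * S.pt y = S.pt (if h : x = y then x else S.third h) := by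
      intro x y h
      rw [dif_neg h, S.pt_mul_pt h]
    refine ⟨fun x => dif_pos rfl, fun x y => ?_, fun x y => ?_⟩
    · by_cases h : x = y
      · rw [h]
      · apply S.pt_injective
        rw [← key h, ← key (Ne.symm h), hL.mul_comm]
    · by_cases h : x = y
      · simp [h]
      · have h' : x ≠ if h : x = y then x else S.third h := by
          intro e
          have e2 := key h
          rw [← e] at e2
          have : S.pt x * S.pt y = S.pt x * 1 := by rw [e2, hL.mul_one]
          exact S.pt_ne_one y (hL.mul_cancel this)
        apply S.pt_injective
        rw [← key h', ← key h, hL.mul_mul]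
  · rw [S.pt_mul_pt h]
    exact congrArg S.pt (dif_neg h).symm

theorem HasProd.center_eq {S : STS α} {m : α → α → α} (hS : S.HasProd m)
    (h : ∀ x, ∃ a c, x ≠ a ∧ a ≠ c ∧ m x a ≠ c ∧ x ≠ m a c ∧ m (m x a) c ≠ m x (m a c)) :
    Set.center S.Loop = {1} := by
  ext a
  rw [S.isSteinerLoop_loop.mem_center, Set.mem_singleton_iff]
  constructor
  · intro ha
    rcases S.eq_one_or_pt a with rfl | ⟨x, rfl⟩
    · rfl
    · obtain ⟨b, c, h1, h2, h3, h4, h5⟩ := h x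
      have := ha (S.pt b) (S.pt c)
      rw [hS _ _ h2, hS _ _ h4, hS _ _ h1, hS _ _ h3] at this
      exact absurd (S.pt_injective this).symm h5
  · rintro rfl b c
    rw [loop_one_mul, loop_one_mul]

theorem Numbering.isSteinerProd {n N : ℕ} {m : Fin n → Fin n → Fin n} {blk : Fin n → Fin n → Fin N}
    {fst snd : Fin N → Fin n} (h : Numbering m blk fst snd) : IsSteinerProd m :=
  ⟨h.self, h.comm, h.mul_mul⟩

theorem Numbering.hasProd {n N : ℕ} {m : Fin n → Fin n → Fin n} {blk : Fin n → Fin n → Fin N}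
    {fst snd : Fin N → Fin n} (h : Numbering m blk fst snd) : h.sys.HasProd m :=
  fun _ _ hne => h.pt_mul hne

/-- The list of points that arises from three points by adding products of listed points. -/
def generate (m : α → α → α) (steps : List (ℕ × ℕ)) (a b c : α) : List α :=
  steps.foldl (fun l s => l ++ [m (l.getD s.1 a) (l.getD s.2 a)]) [a, b, c]

theorem generate_map {m : α → α → α} {σ : α → α} (hσ : ∀ x y, σ (m x y) = m (σ x) (σ y))
    (steps : List (ℕ × ℕ)) (a b c : α) :
    generate m steps (σ a) (σ b) (σ c) = (generate m steps a b c).map σ := by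
  have key : ∀ l : List α,
      steps.foldl (fun l s => l ++ [m (l.getD s.1 (σ a)) (l.getD s.2 (σ a))]) (l.map σ) =
        (steps.foldl (fun l s => l ++ [m (l.getD s.1 a) (l.getD s.2 a)]) l).map σ := by
    induction steps with
    | nil => intro l; rfl
    | cons s steps ih =>
      intro l
      rw [List.foldl_cons, List.foldl_cons, ← ih]
      simp [hσ]
  exact key [a, b, c]

/-- Each relation `(i, j, k)` of `rels` holds in the list `l`: the product of the entries with
indices `i` and `j` is the entry with index `k`. -/
def satisfies [DecidableEq α] (m : α → α → α) (rels : List (ℕ × ℕ × ℕ)) (d : α) (l : List α) :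
    Bool :=
  rels.all fun r => decide (m (l.getD r.1 d) (l.getD r.2.1 d) = l.getD r.2.2 d)

/-- If the candidates for the images of three generators in a Pasch configuration that pass the test `satisfies` come from
the maps `g i`, then every endomorphism is one of these maps. -/
theorem exists_eq_of_satisfies [DecidableEq α] {m : α → α → α} {ι : Type*} (g : ι → α → α)
    (steps : List (ℕ × ℕ)) (rels : List (ℕ × ℕ × ℕ)) (a b c : α)
    (hrels : satisfies m rels a (generate m steps a b c) = true)
    (hall : ∀ x, x ∈ generate m steps a b c)
    (hab : a ≠ b) (hp : m (m a b) (m a c) = m b c)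
    (hg : ∀ a' b' c', a' ≠ b' → m (m a' b') (m a' c') = m b' c' → satisfies m rels a' (generate m steps a' b' c') = true →
      ∃ i, (generate m steps a b c).map (g i) = generate m steps a' b' c')
    {σ : α → α} (hσ : ∀ x y, σ (m x y) = m (σ x) (σ y)) (hi : Function.Injective σ) :
    ∃ i, σ = g i := by
  -- The images of the generators again form a Pasch configuration and satisfy the same relations.
  have h := hg (σ a) (σ b) (σ c) (hi.ne hab) (by simp only [← hσ, hp]) (by
    rw [generate_map hσ]
    simp only [satisfies, List.all_eq_true, decide_eq_true_eq] at hrels ⊢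
    intro r hr
    rw [List.getD_map, List.getD_map, List.getD_map, ← hσ, hrels r hr])
  obtain ⟨i, hi⟩ := h
  rw [generate_map hσ, List.map_inj_left] at hi
  exact ⟨i, funext fun x => (hi x (hall x)).symm⟩

/-- All products in the list `l`, as relations between the indices. -/
def allRels [DecidableEq α] (m : α → α → α) (d : α) (l : List α) : List (ℕ × ℕ × ℕ) :=
  (PartialTable.pairs l.length).map fun p =>
    (p.1, p.2, l.idxOf (m (l.getD p.1 d) (l.getD p.2 d)))

/-- The quotient system is determined up to isomorphism and is one of `A` and `C`, so the classes
are the disjoint union of the classes over each. -/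
theorem card_isoClasses_add {A C : STS (Fin 13)} (hA : Set.center A.Loop = {1})
    (hcover : ∀ Q : STS (Fin 13), Q.Isomorphic A ∨ Q.Isomorphic C)
    (hAC : ¬ A.Isomorphic C) [Finite (IsoClasses 27 (HasOneVeblenOver A))]
    [Finite (IsoClasses 27 (HasOneVeblenOver C))] :
    (∀ S : STS (Fin 27), S.HasOneVeblen →
        (S.IsQuotientSystem A ∧ ¬ S.IsQuotientSystem C) ∨
        (S.IsQuotientSystem C ∧ ¬ S.IsQuotientSystem A)) ∧
    Nat.card (IsoClasses 27 HasOneVeblen) = Nat.card (IsoClasses 27 (HasOneVeblenOver A)) +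
      Nat.card (IsoClasses 27 (HasOneVeblenOver C)) := by
  have hex : ∀ S : STS (Fin 27), S.IsQuotientSystem A → ¬ S.IsQuotientSystem C := by
    rintro S ⟨e⟩ ⟨e'⟩
    exact hAC (isomorphic_iff.2 ⟨e.symm.trans e'⟩)
  have hor : ∀ S : STS (Fin 27), S.HasOneVeblen → S.IsQuotientSystem A ∨ S.IsQuotientSystem C := by
    intro S hS
    obtain ⟨Q, ⟨e⟩⟩ := exists_quotientSystem hS
    rcases hcover Q with h | h
    · obtain ⟨k⟩ := isomorphic_iff.1 h
      exact Or.inl ⟨e.trans k⟩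
    · obtain ⟨k⟩ := isomorphic_iff.1 h
      exact Or.inr ⟨e.trans k⟩
  have htr : ∀ (Q : STS (Fin 13)) (S T : STS (Fin 27)), Set.center Q.Loop = {1} →
      S.Isomorphic T → HasOneVeblenOver Q S → HasOneVeblenOver Q T := by
    intro Q S T hQ h hS
    obtain ⟨f, ⟨e⟩⟩ := exists_extension hS
    obtain ⟨k⟩ := isomorphic_iff.1 h
    exact hasOneVeblenOver_of_extension hQ f (k.symm.trans e)
  refine ⟨fun S hS => ?_, ?_⟩
  · rcases hor S hS with h | h
    · exact Or.inl ⟨h, hex S h⟩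
    · exact Or.inr ⟨h, fun h' => hex S h' h⟩
  · rw [← Nat.card_sum]
    symm
    let F (Q : STS (Fin 13)) : IsoClasses 27 (HasOneVeblenOver Q) → IsoClasses 27 HasOneVeblen :=
      Quotient.map (fun S => ⟨S.1, S.2.1⟩) fun _ _ h => h
    have hF : ∀ Q, Function.Injective (F Q) := by
      intro Q a b
      induction a, b using Quotient.inductionOn₂ with
      | h S T =>
        intro h
        have h : S.1.Isomorphic T.1 :=
          Quotient.exact (s := isoSetoid 27 HasOneVeblen) h
        exact Quotient.sound h
    refine Nat.card_eq_of_bijective (Sum.elim (F A) (F C)) ⟨?_, ?_⟩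
    · refine (hF A).sumElim (hF C) fun a b => ?_
      induction a, b using Quotient.inductionOn₂ with
      | h S T =>
        intro h
        have h : S.1.Isomorphic T.1 :=
          Quotient.exact (s := isoSetoid 27 HasOneVeblen) h
        exact hex T.1 (htr A S.1 T.1 hA h S.2).2 T.2.2
    · intro c
      induction c using Quotient.inductionOn with
      | h S =>
        rcases hor S.1 S.2 with h | h
        · exact ⟨Sum.inl (Quotient.mk _ ⟨S.1, S.2, h⟩), rfl⟩
        · exact ⟨Sum.inr (Quotient.mk _ ⟨S.1, S.2, h⟩), rfl⟩

theorem card_isoClasses_over {Q : STS (Fin 13)} (hQ : Set.center Q.Loop = {1}) :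
    Nat.card (IsoClasses 27 (HasOneVeblenOver Q)) = Nat.card Q.ExtOrbits := by
  obtain ⟨e, -⟩ := classesCorrespondToOrbits hQ
  exact (Nat.card_congr e).symm

end STS

/-! ### The two systems of order 13 -/

namespace STS13

open STS PartialTable

/-- The multiplication table of the non-cyclic system. -/
def tableA : ℕ := 0xd798bac3216540007c3145d289b6a00093b4d2517ac86000814a2d673b59c000b4d296381c7a5000a52d6819c34b7000cd56317ab2948000321789a645dcb00028731cb456ad900019abc3256487d0006bc5749da83120005689ab4cd71230004a6c578b9d231

/-- The multiplication table of the cyclic system, developed from `{0, 1, 4}` and `{0, 2, 7}`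
modulo 13. -/
def tableC : ℕ := 0xd359a628b1c740003c2489517adb600052b13784d69ca000941ad2673c58b000a83d9c1562b470006972c8bd451a300025861b7ac34d900081475da69b23c000b7d364c958a120001a6c253b8479d000cd95b142a73680007bc84ad31962500046ab739c2d851

/-- A function to the numbers of triples, from its table with five binary digits per entry. -/
def blockNumber (B : ℕ) (x y : Fin 13) : Fin 26 :=
  Fin.ofNat 26 (Nat.mod (Nat.shiftRight B (Nat.mul 5 (Nat.add (Nat.mul 13 x) y))) 32)

/-- A list of 26 points, from its hexadecimal code. -/
def blockPoint (F : ℕ) (j : Fin 26) : Fin 13 :=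
  Fin.ofNat 13 (Nat.mod (Nat.shiftRight F (Nat.mul 4 j)) 16)

/-- The numbers of the triples of the non-cyclic system. -/
def blkA : Fin 13 → Fin 13 → Fin 26 := blockNumber
  0xbe719c5da70b4e1b81e58d2e8a45e82e5e0965331ce4f48f0590158ad592628b98e540b3ac28b942c5138b0096a2d6925ef3ab880accce311a81d6d6a82106a067a4d82a4e00830e20c6528acd0801660b5ef6396e6b160000e84a949320e60000128ca22106208000

/-- The numbers of the triples of the cyclic system. -/
def blkC : Fin 13 → Fin 13 → Fin 26 := blockNumber
  0x5dd089665762f2c5815639e388d96ac5d404d4c685e155251648114295f67d1283d5003cc84755d391cd4380d218db46e6262ccc02c442cce588149228090087178dde41c4801bc0065a1670c501804e62d757d5a20bc400b72a551d4c840e0800cc25336cf0063400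

/-- First points of the triples of the non-cyclic system. -/
def fstA : Fin 26 → Fin 13 := blockPoint 0x87655443332222211111000000

/-- Second points of the triples of the non-cyclic system. -/
def sndA : Fin 26 → Fin 13 := blockPoint 0xa9b7676984a654387543965431

/-- First points of the triples of the cyclic system. -/
def fstC : Fin 26 → Fin 13 := blockPoint 0x10432105432100210876543210

/-- Second points of the triples of the cyclic system. -/
def sndC : Fin 26 → Fin 13 := blockPoint 0x65a98767654323ba9987654321

theorem numberingA : Numbering (prod tableA) blkA fstA sndA where
  self := by decide +kernel
  comm := by decide +kernel
  mul_mul := by decide +kernel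
  blk_comm := by decide +kernel
  blk_mul := by decide +kernel
  fst_ne := by decide +kernel
  blk_fst := by decide +kernel
  mem_blk := by decide +kernel

theorem numberingC : Numbering (prod tableC) blkC fstC sndC where
  self := by decide +kernel
  comm := by decide +kernel
  mul_mul := by decide +kernel
  blk_comm := by decide +kernel
  blk_mul := by decide +kernel
  fst_ne := by decide +kernel
  blk_fst := by decide +kernel
  mem_blk := by decide +kernel

/-- The non-cyclic system of order 13. -/
def sysA : STS (Fin 13) := numberingA.sys

/-- The cyclic system of order 13. -/
def sysC : STS (Fin 13) := numberingC.sys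

/-- The first point of the target Pasch configuration runs only through representatives of the point
orbits under the affine maps (`0`) and under S_3 (`0`, `3`, `6`, `12`). This shortens the search;
soundness does not depend on it. -/
theorem search_leafIso : search (fun _ _ _ _ => false)
    (leafIso (cands tableC [0] ++ cands tableA [0, 3, 6, 12])) 40 paschTable 6 (pairs 6) =
      true := by
  decide +kernel

theorem boundedA : Bounded tableA := by
  unfold Bounded
  decide +kernel

theorem boundedC : Bounded tableC := by
  unfold Bounded
  decide +kernel

theorem fst_eq_of_mem_cands {U : ℕ} {as : List ℕ} {c : ℕ × ℕ × ℕ × ℕ} (h : c ∈ cands U as) :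
    c.1 = U := by
  simp only [cands, List.mem_flatMap, List.mem_map] at h
  obtain ⟨-, -, -, -, -, -, rfl⟩ := h
  rfl

theorem isomorphic_or (Q : STS (Fin 13)) : Q.Isomorphic sysA ∨ Q.Isomorphic sysC := by
  obtain ⟨m, hm, hQ⟩ := Q.exists_hasProd
  obtain ⟨p, hp⟩ := exists_model_pasch hm
  have hcases : ∀ c ∈ cands tableC [0] ++ cands tableA [0, 3, 6, 12],
      c.1 = tableA ∨ c.1 = tableC := by
    intro c hc
    rcases List.mem_append.1 hc with h | h
    · exact Or.inr (fst_eq_of_mem_cands h)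
    · exact Or.inl (fst_eq_of_mem_cands h)
  obtain ⟨c, hc, φ, hφ⟩ := search_sound hm (fun _ _ _ _ _ _ _ _ h => by cases h)
    (leafIso_sound hm (fun c hc => by
      rcases hcases c hc with h | h
      · rw [h]
        exact ⟨boundedA, numberingA.isSteinerProd⟩
      · rw [h]
        exact ⟨boundedC, numberingC.isSteinerProd⟩))
    40 _ _ _ p hp (fun q hq => mem_pairs.1 hq) search_leafIso
  rcases hcases c hc with h | h <;> rw [h] at hφ
  · exact Or.inl ⟨φ, hQ.triples_iff numberingA.hasProd φ hφ⟩
  · exact Or.inr ⟨φ, hQ.triples_iff numberingC.hasProd φ hφ⟩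

theorem not_veblenA : ∀ x, ∃ a c, x ≠ a ∧ a ≠ c ∧ prod tableA x a ≠ c ∧ x ≠ prod tableA a c ∧
    prod tableA (prod tableA x a) c ≠ prod tableA x (prod tableA a c) := by
  decide +kernel

theorem not_veblenC : ∀ x, ∃ a c, x ≠ a ∧ a ≠ c ∧ prod tableC x a ≠ c ∧ x ≠ prod tableC a c ∧
    prod tableC (prod tableC x a) c ≠ prod tableC x (prod tableC a c) := by
  decide +kernel

theorem centerA : Set.center sysA.Loop = {1} := numberingA.hasProd.center_eq not_veblenA

theorem centerC : Set.center sysC.Loop = {1} := numberingC.hasProd.center_eq not_veblenC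

/-! ### The automorphism groups -/

/-- The map of the points of the non-cyclic system that comes from the map `0 ↦ a`, `1 ↦ b`,
`2 ↦ c` of three letters: the points are two copies of the letters, the ordered pairs of different
letters, and one fixed point. -/
def mapA (a b c : Fin 3) : Fin 13 → Fin 13 :=
  let p (i : Fin 3) (d : ℕ) : Fin 13 := Fin.ofNat 13 ((i : ℕ) + d)
  let q (i j : Fin 3) : Fin 13 :=
    Fin.ofNat 13 (6 + 2 * (i : ℕ) + if i < j then (j : ℕ) - 1 else j)
  ![p a 0, p b 0, p c 0, p a 3, p b 3, p c 3, q a b, q a c, q b a, q b c, q c a, q c b, 12]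

theorem mapA_mapA : ∀ a b c : Fin 3, a ≠ b → a ≠ c → b ≠ c → ∀ u v w : Fin 3, u ≠ v → u ≠ w →
    v ≠ w → ∀ x, mapA (![a, b, c] u) (![a, b, c] v) (![a, b, c] w) x =
      mapA a b c (mapA u v w x) := by
  decide +kernel

theorem mapA_prod : ∀ a b c : Fin 3, a ≠ b → a ≠ c → b ≠ c → ∀ x y,
    mapA a b c (prod tableA x y) = prod tableA (mapA a b c x) (mapA a b c y) := by
  decide +kernel

theorem mapA_injective : ∀ a b c u v w : Fin 3, mapA a b c 0 = mapA u v w 0 →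
    mapA a b c 1 = mapA u v w 1 → mapA a b c 2 = mapA u v w 2 → a = u ∧ b = v ∧ c = w := by
  decide +kernel

/-- The action of the symmetric group on the points of the non-cyclic system. -/
def actA (s : Equiv.Perm (Fin 3)) : Fin 13 → Fin 13 := mapA (s 0) (s 1) (s 2)

theorem perm_ne (s : Equiv.Perm (Fin 3)) : s 0 ≠ s 1 ∧ s 0 ≠ s 2 ∧ s 1 ≠ s 2 := by
  simp [s.injective.ne_iff]

theorem actA_mul (s t : Equiv.Perm (Fin 3)) (x : Fin 13) :
    actA (s * t) x = actA s (actA t x) := by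
  have h : ∀ i, s i = ![s 0, s 1, s 2] i := by
    intro i
    fin_cases i <;> rfl
  have hs := perm_ne s
  have ht := perm_ne t
  rw [actA, Equiv.Perm.mul_apply, Equiv.Perm.mul_apply, Equiv.Perm.mul_apply, h (t 0), h (t 1),
    h (t 2)]
  exact mapA_mapA _ _ _ hs.1 hs.2.1 hs.2.2 _ _ _ ht.1 ht.2.1 ht.2.2 x

theorem actA_one : ∀ x : Fin 13, actA 1 x = x := by decide +kernel

theorem actA_prod (s : Equiv.Perm (Fin 3)) (x y : Fin 13) :
    actA s (prod tableA x y) = prod tableA (actA s x) (actA s y) :=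
  mapA_prod _ _ _ (perm_ne s).1 (perm_ne s).2.1 (perm_ne s).2.2 x y

theorem actA_injective (s t : Equiv.Perm (Fin 3)) (h : ∀ x, actA s x = actA t x) : s = t := by
  obtain ⟨h0, h1, h2⟩ := mapA_injective _ _ _ _ _ _ (h 0) (h 1) (h 2)
  ext i
  fin_cases i
  exacts [congrArg _ h0, congrArg _ h1, congrArg _ h2]

/-- The action of the symmetric group on the non-cyclic system. -/
def permA : Equiv.Perm (Fin 3) →* sysA.aut where
  toFun s := ⟨⟨actA s, actA s⁻¹, fun x => by rw [← actA_mul, inv_mul_cancel, actA_one],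
    fun x => by rw [← actA_mul, mul_inv_cancel, actA_one]⟩,
    (numberingA.hasProd.mem_aut numberingA.isSteinerProd).2 (actA_prod s)⟩
  map_one' := Subtype.ext (Equiv.ext actA_one)
  map_mul' s t := Subtype.ext (Equiv.ext (actA_mul s t))

/-- Steps that generate each system from three suitable points of a Pasch configuration. -/
def steps : List (ℕ × ℕ) :=
  [(0, 1), (0, 2), (1, 2), (2, 3), (1, 4), (0, 5), (0, 6), (1, 6), (4, 6), (5, 6)]

/-- The relations of the non-cyclic system, in terms of its list of generated points. -/
def relsA : List (ℕ × ℕ × ℕ) :=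
  allRels (prod tableA) 0 (generate (prod tableA) steps 0 1 5)

/-- The relations of the cyclic system, in terms of its list of generated points. -/
def relsC : List (ℕ × ℕ × ℕ) :=
  allRels (prod tableC) 0 (generate (prod tableC) steps 0 1 7)

/-- The points 0, 1, 5 generate the system. The Pasch hypothesis comes first so that few triples of
images reach the full test of relations. -/
theorem satisfiesA : ∀ a b c : Fin 13, a ≠ b →
    prod tableA (prod tableA a b) (prod tableA a c) = prod tableA b c →
    satisfies (prod tableA) relsA a (generate (prod tableA) steps a b c) = true →
    ∃ s, (generate (prod tableA) steps 0 1 5).map (actA s) =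
      generate (prod tableA) steps a b c := by
  decide +kernel

theorem exists_actA {σ : Fin 13 → Fin 13}
    (hσ : ∀ x y, σ (prod tableA x y) = prod tableA (σ x) (σ y)) (hi : Function.Injective σ) :
    ∃ s, σ = actA s :=
  exists_eq_of_satisfies actA steps relsA 0 1 5 (by decide +kernel) (by decide +kernel)
    (by decide) (by decide +kernel) satisfiesA hσ hi

theorem permA_bijective : Function.Bijective permA := by
  constructor
  · intro s t h
    exact actA_injective s t fun x => DFunLike.congr_fun (congrArg Subtype.val h) x
  · rintro ⟨σ, hσ⟩
    obtain ⟨s, hs⟩ := exists_actA ((numberingA.hasProd.mem_aut numberingA.isSteinerProd).1 hσ)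
      σ.injective
    exact ⟨s, Subtype.ext (Equiv.ext fun x => (congrFun hs x).symm)⟩

/-- The automorphism group of the non-cyclic system. -/
noncomputable def autA : Equiv.Perm (Fin 3) ≃* sysA.aut := MulEquiv.ofBijective permA permA_bijective

theorem not_isCyclicA : ¬ sysA.IsCyclic := by
  rintro ⟨σ, hσ, h⟩
  obtain ⟨s, hs⟩ := permA_bijective.2 ⟨σ, hσ⟩
  -- All automorphisms fix the point 12, which rules out a single cycle on the points.
  have h12 : ∀ s, actA s 12 = 12 := fun s => rfl
  have hfix : σ 12 = 12 := by
    have : σ = (permA s).1 := (congrArg Subtype.val hs).symm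
    rw [this]
    exact h12 s
  obtain ⟨k, hk⟩ := h 12 0
  rw [Function.IsFixedPt.perm_zpow hfix k] at hk
  exact absurd hk (by decide)

/-- The affine maps with multipliers `1`, `3` and `9`. -/
def actC (i : Fin 3 × Fin 13) (x : Fin 13) : Fin 13 := ![1, 3, 9] i.1 * x + i.2

theorem actC_prod : ∀ (i : Fin 3 × Fin 13) (x y : Fin 13),
    actC i (prod tableC x y) = prod tableC (actC i x) (actC i y) := by
  decide +kernel

theorem actC_injective : ∀ i, Function.Injective (actC i) := by
  unfold Function.Injective
  decide +kernel

theorem eq_of_actC : ∀ i j : Fin 3 × Fin 13, (∀ x, actC i x = actC j x) → i = j := by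
  decide +kernel

theorem satisfiesC : ∀ a b c : Fin 13, a ≠ b →
    prod tableC (prod tableC a b) (prod tableC a c) = prod tableC b c →
    satisfies (prod tableC) relsC a (generate (prod tableC) steps a b c) = true →
    (generate (prod tableC) steps 0 1 7).map
      -- An affine map with 0 ↦ a and 1 ↦ b has translation part a and multiplier b − a.
      (actC (if b - a = 1 then 0 else if b - a = 3 then 1 else 2, a)) =
        generate (prod tableC) steps a b c := by
  decide +kernel

theorem exists_actC {σ : Fin 13 → Fin 13}
    (hσ : ∀ x y, σ (prod tableC x y) = prod tableC (σ x) (σ y)) (hi : Function.Injective σ) :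
    ∃ i, σ = actC i :=
  exists_eq_of_satisfies actC steps relsC 0 1 7 (by decide +kernel) (by decide +kernel)
    (by decide) (by decide +kernel) (fun a b c hab hp h => ⟨_, satisfiesC a b c hab hp h⟩) hσ hi

/-- The affine maps, as automorphisms of the cyclic system. -/
noncomputable def permC (i : Fin 3 × Fin 13) : sysC.aut :=
  ⟨Equiv.ofBijective (actC i) (Finite.injective_iff_bijective.1 (actC_injective i)),
    (numberingC.hasProd.mem_aut numberingC.isSteinerProd).2 (actC_prod i)⟩

theorem permC_bijective : Function.Bijective permC := by
  constructor
  · intro i j h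
    exact eq_of_actC i j fun x => DFunLike.congr_fun (congrArg Subtype.val h) x
  · rintro ⟨σ, hσ⟩
    obtain ⟨i, hs⟩ := exists_actC ((numberingC.hasProd.mem_aut numberingC.isSteinerProd).1 hσ)
      σ.injective
    exact ⟨i, Subtype.ext (Equiv.ext fun x => (congrFun hs x).symm)⟩

theorem aut_sysC : (sysC.aut : Subgroup (Equiv.Perm (ZMod 13))) = frobenius39 := by
  ext σ
  constructor
  · intro hσ
    obtain ⟨i, hi⟩ := permC_bijective.2 ⟨σ, hσ⟩
    have hi : ∀ x, actC i x = σ x := fun x => DFunLike.congr_fun (congrArg Subtype.val hi) x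
    refine ⟨![1, 3, 9] i.1, ?_, i.2, fun x => (hi x).symm⟩
    generalize i.1 = k
    revert k
    have h : ∀ k : Fin 3, (![1, 3, 9] k : ZMod 13) = 1 ∨ (![1, 3, 9] k : ZMod 13) = 3 ∨
        (![1, 3, 9] k : ZMod 13) = 9 := by decide
    exact h
  · rintro ⟨a, ha, b, hσ⟩
    have : ∃ k : Fin 3, a = (![1, 3, 9] k : ZMod 13) := by
      rcases ha with rfl | rfl | rfl
      exacts [⟨0, rfl⟩, ⟨1, rfl⟩, ⟨2, rfl⟩]
    obtain ⟨k, rfl⟩ := this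
    have e : (permC (k, b)).1 = σ := Equiv.ext fun x => (hσ x).symm
    rw [← e]
    exact (permC (k, b)).2

theorem isCyclicC : sysC.IsCyclic := by
  -- The index `(0, 1)` is the translation x ↦ x + 1.
  refine ⟨(permC (0, 1)).1, (permC (0, 1)).2, fun x y => ?_⟩
  have h : ∀ (k : ℕ) (x : Fin 13), ((permC (0, 1)).1 ^ k) x = (actC (0, 1))^[k] x := by
    intro k x
    rw [Equiv.Perm.coe_pow]
    rfl
  have h2 : ∀ x y : Fin 13, ∃ k : Fin 13, (actC (0, 1))^[k] x = y := by decide +kernel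
  obtain ⟨k, hk⟩ := h2 x y
  exact ⟨k, by rw [zpow_natCast, h, hk]⟩

/-- Isomorphic systems would have automorphism groups of equal order, but the orders are 6 and 39.
-/
theorem not_isomorphic : ¬ sysA.Isomorphic sysC := by
  intro h
  obtain ⟨e⟩ := isomorphic_iff.1 h
  let k : MulAut sysA.Loop ≃ MulAut sysC.Loop :=
    { toFun := fun f => (e.symm.trans f).trans e
      invFun := fun f => (e.trans f).trans e.symm
      left_inv := fun f => by ext; simp
      right_inv := fun f => by ext; simp }
  have h1 := Nat.card_congr (autA.toEquiv.trans (sysA.autEquiv.toEquiv.trans k))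
  have h2 := Nat.card_congr
    ((Equiv.ofBijective permC permC_bijective).trans sysC.autEquiv.toEquiv)
  rw [← h2] at h1
  simp [Nat.card_eq_fintype_card, Fintype.card_perm, Nat.factorial] at h1

/-! ### Evaluation of the counts -/

theorem relDim_colU_A : XorCount.relDim 13 (List.ofFn (Numbering.colU (prod tableA) fstA sndA)) = 0 := by
  decide +kernel

theorem relDim_colU_C : XorCount.relDim 13 (List.ofFn (Numbering.colU (prod tableC) fstC sndC)) = 0 := by
  decide +kernel

theorem card_extClassesA : Nat.card sysA.ExtClasses = 2 ^ 13 := by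
  have := numberingA.card_extClasses relDim_colU_A
  rw [show (2 : ℕ) ^ 26 = 2 ^ 13 * 2 ^ 13 from rfl] at this
  exact Nat.eq_of_mul_eq_mul_left (by norm_num) this

theorem card_extClassesC : Nat.card sysC.ExtClasses = 2 ^ 13 := by
  have := numberingC.card_extClasses relDim_colU_C
  rw [show (2 : ℕ) ^ 26 = 2 ^ 13 * 2 ^ 13 from rfl] at this
  exact Nat.eq_of_mul_eq_mul_left (by norm_num) this

/-- The Burnside sum, scaled by the number 2^13 of coboundaries; 6 is the order of the group. -/
theorem sum_relDimA : ∑ s, 2 ^ XorCount.relDim (26 + 13)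
    (List.ofFn (Numbering.colV blkA fstA sndA (actA s)) ++
      List.ofFn (Numbering.colU (prod tableA) fstA sndA)) = 2 ^ 13 * (1504 * 6) := by
  decide +kernel

/-- The same sum for the affine group of order 39. -/
theorem sum_relDimC : ∑ i, 2 ^ XorCount.relDim (26 + 13)
    (List.ofFn (Numbering.colV blkC fstC sndC (actC i)) ++
      List.ofFn (Numbering.colU (prod tableC) fstC sndC)) = 2 ^ 13 * (232 * 39) := by
  decide +kernel

theorem card_extOrbitsA : Nat.card sysA.ExtOrbits = 1504 := by
  have h := numberingA.card_orbits relDim_colU_A autA.toEquiv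
  have h := h.trans sum_relDimA
  have hc : Fintype.card (Equiv.Perm (Fin 3)) = 6 := by decide
  rw [hc] at h
  exact Nat.eq_of_mul_eq_mul_right (by norm_num) (Nat.eq_of_mul_eq_mul_left (by norm_num) h)

theorem card_extOrbitsC : Nat.card sysC.ExtOrbits = 232 := by
  have h := numberingC.card_orbits relDim_colU_C (Equiv.ofBijective permC permC_bijective)
  have h := h.trans sum_relDimC
  have hc : Fintype.card (Fin 3 × Fin 13) = 39 := by simp
  rw [hc] at h
  exact Nat.eq_of_mul_eq_mul_right (by norm_num) (Nat.eq_of_mul_eq_mul_left (by norm_num) h)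

end STS13

/-! ### The theorem -/

theorem mainTheorem2 :
    Nat.card (STS.IsoClasses 27 STS.HasOneVeblen) = 1736 ∧
    ∃ A C : STS (Fin 13),
      ¬ A.IsCyclic ∧ C.IsCyclic ∧
      (∀ Q : STS (Fin 13), Q.Isomorphic A ∨ Q.Isomorphic C) ∧
      (∀ S : STS (Fin 27), S.HasOneVeblen →
        (S.IsQuotientSystem A ∧ ¬ S.IsQuotientSystem C) ∨
        (S.IsQuotientSystem C ∧ ¬ S.IsQuotientSystem A)) ∧
      (Nat.card (STS.IsoClasses 27 (STS.HasOneVeblenOver A)) = 1504 ∧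
        Nonempty (A.aut ≃* Equiv.Perm (Fin 3)) ∧
        Nonempty (MulAut A.Loop ≃* Equiv.Perm (Fin 3)) ∧
        Nat.card A.ExtClasses = 2 ^ 13 ∧
        Nat.card A.ExtOrbits = 1504 ∧
        A.ClassesCorrespondToOrbits) ∧
      (Nat.card (STS.IsoClasses 27 (STS.HasOneVeblenOver C)) = 232 ∧
        Nonempty (C.aut ≃* frobenius39) ∧
        Nonempty (MulAut C.Loop ≃* frobenius39) ∧
        Nat.card C.ExtClasses = 2 ^ 13 ∧
        Nat.card C.ExtOrbits = 232 ∧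
        C.ClassesCorrespondToOrbits) := by
  have hA : Nat.card (STS.IsoClasses 27 (STS.HasOneVeblenOver STS13.sysA)) = 1504 :=
    (STS.card_isoClasses_over STS13.centerA).trans STS13.card_extOrbitsA
  have hC : Nat.card (STS.IsoClasses 27 (STS.HasOneVeblenOver STS13.sysC)) = 232 :=
    (STS.card_isoClasses_over STS13.centerC).trans STS13.card_extOrbitsC
  -- `Nat.card` is zero on infinite types, so the nonzero counts yield the finiteness needed to add
  -- them.
  have : Finite (STS.IsoClasses 27 (STS.HasOneVeblenOver STS13.sysA)) :=
    Nat.finite_of_card_ne_zero (by rw [hA]; norm_num)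
  have : Finite (STS.IsoClasses 27 (STS.HasOneVeblenOver STS13.sysC)) :=
    Nat.finite_of_card_ne_zero (by rw [hC]; norm_num)
  obtain ⟨hex, hsum⟩ := STS.card_isoClasses_add STS13.centerA
    STS13.isomorphic_or STS13.not_isomorphic
  have autC : Nonempty (STS13.sysC.aut ≃* frobenius39) :=
    ⟨MulEquiv.subgroupCongr STS13.aut_sysC⟩
  refine ⟨by rw [hsum, hA, hC], STS13.sysA, STS13.sysC, STS13.not_isCyclicA, STS13.isCyclicC,
    STS13.isomorphic_or, hex,
    ⟨hA, ⟨STS13.autA.symm⟩, ⟨STS13.sysA.autEquiv.symm.trans STS13.autA.symm⟩,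
      STS13.card_extClassesA, STS13.card_extOrbitsA, STS.classesCorrespondToOrbits STS13.centerA⟩,
    ⟨hC, autC, autC.map fun e => STS13.sysC.autEquiv.symm.trans e,
      STS13.card_extClassesC, STS13.card_extOrbitsC, STS.classesCorrespondToOrbits STS13.centerC⟩⟩
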